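/- Let $\mathbb T$ be the unit circle with normalised arc length, $L^2=L^2(\mathbb T)$, $L^\infty=L^\infty(\mathbb T)$, let $P_+$ be the orthogonal projection of $L^2$ onto the Hardy space $H^2$ (the closed span of $z^n$, $n\ge 0$) and $P_-=I-P_+$. For $H=\begin{pmatrix} f&\phi\\ g&\psi\end{pmatrix}$ with $f,g,\phi,\psi\in L^\infty$ let $$R_H=P_+fP_++P_-gP_++P_+\phi P_-+P_-\psi P_-$$ on $L^2$, where functions act by multiplication. Let $\mathfrak R_{L^\infty}$ be the C*-algebra generated by all these $R_H$ (the norm closure of the finite sums of finite products of them), $\mathcal K$ the set of compact operators on $L^2$, and $L^\infty_2=L^\infty\times L^\infty$ with coordinatewise operations. Let $k_w(z)=\sqrt{1-|w|^2}/(1-\bar w z)$, $|w|<1$, be the normalised reproducing kernels of $H^2$. Then $\mathcal K\subset\mathfrak R_{L^\infty}$, and for every $T\in\mathfrak R_{L^\infty}$ the limits $$\rho(T)(\xi)=\Bigl(\lim_{r\to1^-}\langle Tk_{r\xi},k_{r\xi}\rangle,\ \lim_{r\to1^-}\langle T\,\bar z\bar k_{r\xi},\bar z\bar k_{r\xi}\rangle\Bigr)$$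 exist for almost every $\xi\in\mathbb T$ and define an element $\rho(T)\in L^\infty_2$. Let $\pi:\mathfrak R_{L^\infty}\to\mathfrak R_{L^\infty}/\mathcal K$ be the quotient map. There exists a *-homomorphism $\zeta$ from $\mathfrak R_{L^\infty}/\mathcal K$ onto $L^\infty_2$ such that $\zeta\circ\pi=\rho$. Moreover: 1. for every $T\in\mathfrak R_{L^\infty}$, if $T$ is Fredholm, then $\rho(T)$ is invertible in $L^\infty_2$; 2. for all $f,g,\phi,\psi\in L^\infty$, $\ \mathrm{Ran}_{ess}f\cup\mathrm{Ran}_{ess}\psi\subset\sigma_e(R_H)$, where $\mathrm{Ran}_{ess}$ is the essential range and $\sigma_e(R_H)$ is the set of $\lambda\in\mathbb C$ for which $R_H-\lambda I$ is not Fredholm. -/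

import Mathlib

open MeasureTheory Filter Topology
open scoped ENNReal InnerProductSpace Matrix

noncomputable section

namespace GSIO

/-! ### The circle, `L²` and the C*-algebra `L^∞` -/

instance fact_two_pi_pos : Fact (0 < 2 * Real.pi) := ⟨Real.two_pi_pos⟩

/-- The unit circle, parametrised by the angle `θ ∈ ℝ / 2πℤ`; the point of the circle with angle
`θ` is `e^{iθ} = AddCircle.toCircle θ`. -/
abbrev Torus : Type := AddCircle (2 * Real.pi)

/-- Normalised arc length `dθ / 2π`. -/
abbrev arc : Measure Torus := AddCircle.haarAddCircle

/-- The Hilbert space `L²` of the circle. -/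
abbrev L2 : Type := Lp ℂ 2 arc

/-- Classes of measurable functions (modulo equality almost everywhere) form a commutative ring under
Mathlib's pointwise addition and multiplication. -/
instance instCommRingAEEqFun : CommRing (Torus →ₘ[arc] ℂ) :=
  { (inferInstance : AddCommGroup (Torus →ₘ[arc] ℂ)),
    (inferInstance : CommMonoid (Torus →ₘ[arc] ℂ)) with
    left_distrib := fun f g h => by
      refine AEEqFun.induction_on₃ f g h fun f _ g _ h _ => ?_
      simp only [AEEqFun.mk_mul_mk, AEEqFun.mk_add_mk, mul_add]
    right_distrib := fun f g h => by
      refine AEEqFun.induction_on₃ f g h fun f _ g _ h _ => ?_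
      simp only [AEEqFun.mk_mul_mk, AEEqFun.mk_add_mk, add_mul]
    zero_mul := fun f => by
      refine AEEqFun.induction_on f fun f _ => ?_
      simp only [AEEqFun.zero_def, AEEqFun.mk_mul_mk]
      congr 1
      funext x
      simp
    mul_zero := fun f => by
      refine AEEqFun.induction_on f fun f _ => ?_
      simp only [AEEqFun.zero_def, AEEqFun.mk_mul_mk]
      congr 1
      funext x
      simp }

instance instAlgebraAEEqFun : Algebra ℂ (Torus →ₘ[arc] ℂ) :=
  Algebra.ofModule
    (fun c f g => by
      refine AEEqFun.induction_on₂ f g fun f _ g _ => ?_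
      simp only [AEEqFun.smul_mk, AEEqFun.mk_mul_mk, smul_mul_assoc])
    (fun c f g => by
      refine AEEqFun.induction_on₂ f g fun f _ g _ => ?_
      simp only [AEEqFun.smul_mk, AEEqFun.mk_mul_mk, mul_smul_comm])

/-- Pointwise conjugation makes the algebra of classes of measurable functions (modulo equality
almost everywhere) a star ring. -/
instance instStarRingAEEqFun : StarRing (Torus →ₘ[arc] ℂ) where
  star_mul f g := by
    apply AEEqFun.ext
    filter_upwards [AEEqFun.coeFn_star (f * g), AEEqFun.coeFn_mul f g,
      AEEqFun.coeFn_mul (star g) (star f), AEEqFun.coeFn_star f, AEEqFun.coeFn_star g]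
      with x h1 h2 h3 h4 h5
    rw [h1, Pi.star_apply, h2, h3, Pi.mul_apply, Pi.mul_apply, h4, h5, Pi.star_apply, Pi.star_apply,
      star_mul]
  star_add f g := by
    apply AEEqFun.ext
    filter_upwards [AEEqFun.coeFn_star (f + g), AEEqFun.coeFn_add f g,
      AEEqFun.coeFn_add (star f) (star g), AEEqFun.coeFn_star f, AEEqFun.coeFn_star g]
      with x h1 h2 h3 h4 h5
    simp [h1, h2, h3, h4, h5]

instance instStarModuleAEEqFun : StarModule ℂ (Torus →ₘ[arc] ℂ) where
  star_smul c f := by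
    apply AEEqFun.ext
    filter_upwards [AEEqFun.coeFn_star (c • f), AEEqFun.coeFn_smul c f,
      AEEqFun.coeFn_smul (star c) (star f), AEEqFun.coeFn_star f] with x h1 h2 h3 h4
    rw [h1, Pi.star_apply, h2, h3, Pi.smul_apply, Pi.smul_apply, h4, Pi.star_apply, star_smul]

lemma mem_Lp_top_mul {f g : Torus →ₘ[arc] ℂ} (hf : f ∈ Lp ℂ ∞ arc) (hg : g ∈ Lp ℂ ∞ arc) :
    f * g ∈ Lp ℂ ∞ arc := by
  rw [Lp.mem_Lp_iff_memLp] at *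
  exact (memLp_congr_ae (AEEqFun.coeFn_mul f g)).mpr (MemLp.mul (r := ∞) hg hf)

lemma mem_Lp_top_const (c : ℂ) : algebraMap ℂ (Torus →ₘ[arc] ℂ) c ∈ Lp ℂ ∞ arc := by
  rw [Algebra.algebraMap_eq_smul_one]
  refine Lp.const_smul_mem_Lp (𝕜 := ℂ) c (⟨1, ?_⟩ : Lp ℂ ∞ arc)
  rw [Lp.mem_Lp_iff_memLp]
  exact (memLp_congr_ae AEEqFun.coeFn_one).mpr (memLp_top_const (1 : ℂ))

/-- `L^∞` of the circle: the essentially bounded classes, with the pointwise operations and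
pointwise conjugation as involution. -/
def Linf : StarSubalgebra ℂ (Torus →ₘ[arc] ℂ) where
  carrier := {f | f ∈ Lp ℂ ∞ arc}
  mul_mem' := mem_Lp_top_mul
  add_mem' := fun hf hg => (Lp ℂ ∞ arc).add_mem hf hg
  algebraMap_mem' := mem_Lp_top_const
  star_mem' := fun {f} hf => (star (⟨f, hf⟩ : Lp ℂ ∞ arc)).2

/-- An element of `L^∞` as an element of Mathlib's space `Lp ℂ ∞`. -/
def toLpTop (f : Linf) : Lp ℂ ∞ arc := ⟨f.1, f.2⟩

/-! ### Generalized singular integral operators -/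

/-- The Hardy space `H²`: the closed span in `L²` of `z ^ n`, `n ≥ 0`. -/
def H2 : Submodule ℂ L2 :=
  (Submodule.span ℂ (Set.range fun n : ℕ => (fourierLp 2 (n : ℤ) : L2))).topologicalClosure

instance instCompleteSpaceH2 : CompleteSpace H2 :=
  (Submodule.isClosed_topologicalClosure _).completeSpace_coe

/-- The Riesz projection: the orthogonal projection of `L²` onto `H²`. -/
def Pplus : L2 →L[ℂ] L2 := H2.starProjection

/-- `P₋ = I - P₊`. -/
def Pminus : L2 →L[ℂ] L2 := 1 - Pplus

/-- Multiplication by `f ∈ L^∞` on `L²`. -/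
def mulOp (f : Linf) : L2 →L[ℂ] L2 :=
  (ContinuousLinearMap.mul ℂ ℂ).holderL arc ∞ 2 2 (toLpTop f)

/-- The generalized singular integral operator `P₊ f P₊ + P₋ g P₊ + P₊ φ P₋ + P₋ ψ P₋` with symbol
`H = !![f, φ; g, ψ]`. -/
def gsio (H : Matrix (Fin 2) (Fin 2) Linf) : L2 →L[ℂ] L2 :=
  Pplus * mulOp (H 0 0) * Pplus + Pminus * mulOp (H 1 0) * Pplus
    + Pplus * mulOp (H 0 1) * Pminus + Pminus * mulOp (H 1 1) * Pminus

/-- The C*-algebra generated by all generalized singular integral operators with symbols in `L^∞`,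
that is the norm closure of the finite sums of finite products of such operators. -/
def gsioAlgebra : StarSubalgebra ℂ (L2 →L[ℂ] L2) :=
  (StarAlgebra.adjoin ℂ (Set.range gsio)).topologicalClosure

/-! ### The symbol map -/

/-- The normalised reproducing kernel `k_z(ω) = √(1 - |z|²) / (1 - z̄ ω)` of `H²`, for `|z| < 1`
(the formula gives the zero function for `|z| ≥ 1`). -/
def kernelFun (z : ℂ) (θ : Torus) : ℂ :=
  (Real.sqrt (1 - ‖z‖ ^ 2) : ℂ) / (1 - star z * (AddCircle.toCircle θ : ℂ))

lemma continuous_kernelFun (z : ℂ) : Continuous (kernelFun z) := by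
  by_cases hz : ‖z‖ < 1
  · refine Continuous.div continuous_const (by fun_prop) fun θ h => ?_
    have h1 : star z * (AddCircle.toCircle θ : ℂ) = 1 := (sub_eq_zero.mp h).symm
    have h2 := congrArg norm h1
    simp only [norm_mul, norm_star, Circle.norm_coe, mul_one, norm_one] at h2
    exact absurd h2 hz.ne
  · have h0 : kernelFun z = fun _ => 0 := by
      funext θ
      have : Real.sqrt (1 - ‖z‖ ^ 2) = 0 := Real.sqrt_eq_zero_of_nonpos (by nlinarith)
      simp [kernelFun, this]
    rw [h0]
    exact continuous_const

/-- `k_z` as a vector of `L²`. -/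
def kernelPlus (z : ℂ) : L2 :=
  ContinuousMap.toLp (E := ℂ) 2 arc ℂ ⟨kernelFun z, continuous_kernelFun z⟩

/-- The function `ω ↦ ω̄ \overline{k_z(ω)}` as a vector of `L²`. -/
def kernelMinus (z : ℂ) : L2 :=
  ContinuousMap.toLp (E := ℂ) 2 arc ℂ
    ⟨fun θ => star (AddCircle.toCircle θ : ℂ) * star (kernelFun z θ), by
      have := continuous_kernelFun z
      fun_prop⟩

/-- The point `r ξ` of the disc, `ξ = e^{iθ}`. -/
def radial (r : ℝ) (θ : Torus) : ℂ := (r : ℂ) * (AddCircle.toCircle θ : ℂ)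

/-- `p = (a, b)` is the symbol of `T`: for almost every `ξ` on the circle,
`⟨T k_{rξ}, k_{rξ}⟩ → a(ξ)` and `⟨T (z̄ k̄_{rξ}), z̄ k̄_{rξ}⟩ → b(ξ)` as `r → 1⁻`.
(Mathlib's inner product is linear in the second variable.) -/
def HasSymbol (T : L2 →L[ℂ] L2) (p : Linf × Linf) : Prop :=
  (∀ᵐ θ ∂arc, Tendsto
      (fun r : ℝ => ⟪kernelPlus (radial r θ), T (kernelPlus (radial r θ))⟫_ℂ)
      (𝓝[<] 1) (𝓝 (p.1.1 θ))) ∧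
  (∀ᵐ θ ∂arc, Tendsto
      (fun r : ℝ => ⟪kernelMinus (radial r θ), T (kernelMinus (radial r θ))⟫_ℂ)
      (𝓝[<] 1) (𝓝 (p.2.1 θ)))

lemma HasSymbol.unique {T : L2 →L[ℂ] L2} {p q : Linf × Linf} (hp : HasSymbol T p)
    (hq : HasSymbol T q) : p = q := by
  refine Prod.ext (Subtype.ext (AEEqFun.ext ?_)) (Subtype.ext (AEEqFun.ext ?_))
  · filter_upwards [hp.1, hq.1] with θ h1 h2 using tendsto_nhds_unique h1 h2
  · filter_upwards [hp.2, hq.2] with θ h1 h2 using tendsto_nhds_unique h1 h2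

open Classical in
/-- The symbol map `ρ`: the pair of radial limits of `T`, as an element of `L^∞ × L^∞`
(and `0` if these limits do not exist in `L^∞`). -/
def symbolMap (T : gsioAlgebra) : Linf × Linf :=
  if h : ∃ p, HasSymbol T.1 p then h.choose else 0

/-! ### The quotient by the compact operators -/

lemma isCompactOperator_adjoint {T : L2 →L[ℂ] L2} (hT : IsCompactOperator T) :
    IsCompactOperator (star T : L2 →L[ℂ] L2) := by
  set S : L2 →L[ℂ] L2 := star T with hS
  have hST : ∀ x y : L2, ⟪S x, y⟫_ℂ = ⟪x, T y⟫_ℂ := fun x y => by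
    rw [hS, ContinuousLinearMap.star_eq_adjoint, ContinuousLinearMap.adjoint_inner_left]
  have hc : IsCompactOperator (T ∘L S) := hT.comp_clm S
  have htb : TotallyBounded ((T ∘L S) '' Metric.closedBall 0 1) :=
    (IsCompactOperator.isCompact_closure_image_closedBall
      (f := ((T ∘L S : L2 →L[ℂ] L2) : L2 →ₗ[ℂ] L2)) hc 1).totallyBounded.subset subset_closure
  suffices h : TotallyBounded (S '' Metric.closedBall 0 1) by
    change IsCompactOperator (S : L2 →ₗ[ℂ] L2)
    rw [isCompactOperator_iff_isCompact_closure_image_closedBall (S : L2 →ₗ[ℂ] L2) zero_lt_one]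
    exact h.closure.isCompact_of_isClosed isClosed_closure
  rw [Metric.totallyBounded_iff]
  intro ε hε
  obtain ⟨t, hts, htf, hcov⟩ := Metric.finite_approx_of_totallyBounded htb (ε ^ 2 / 2) (by positivity)
  obtain ⟨u, hu, huf, rfl⟩ : ∃ u ⊆ Metric.closedBall (0 : L2) 1, u.Finite ∧ (T ∘L S) '' u = t := by
    obtain ⟨u, hu, hb⟩ := Set.exists_subset_bijOn (Metric.closedBall (0 : L2) 1 ∩ (T ∘L S) ⁻¹' t)
      (T ∘L S)
    refine ⟨u, fun x hx => (hu hx).1, ?_, ?_⟩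
    · exact Set.Finite.of_finite_image (htf.subset (by
        rintro _ ⟨x, hx, rfl⟩
        exact (hu hx).2)) hb.injOn
    · rw [hb.image_eq]
      ext y
      constructor
      · rintro ⟨x, hx, rfl⟩
        exact hx.2
      · intro hy
        obtain ⟨x, hx, rfl⟩ := hts hy
        exact ⟨x, ⟨hx, hy⟩, rfl⟩
  refine ⟨S '' u, huf.image _, ?_⟩
  rintro _ ⟨x, hx, rfl⟩
  obtain ⟨_, ⟨y, hy, rfl⟩, hxy⟩ := Set.mem_iUnion₂.mp (hcov ⟨x, hx, rfl⟩)
  refine Set.mem_iUnion₂.mpr ⟨S y, ⟨y, hy, rfl⟩, ?_⟩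
  rw [Metric.mem_ball, dist_eq_norm] at hxy ⊢
  rw [← map_sub] at hxy ⊢
  have h1 : ‖S (x - y)‖ ^ 2 ≤ ‖x - y‖ * ‖(T ∘L S) (x - y)‖ := by
    have h2 : ‖S (x - y)‖ ^ 2 = ‖⟪S (x - y), S (x - y)⟫_ℂ‖ := by
      rw [inner_self_eq_norm_sq_to_K]
      simp
    rw [h2, hST]
    exact norm_inner_le_norm _ _
  have h3 : ‖x - y‖ ≤ 2 := by
    have hx1 : ‖x‖ ≤ 1 := by simpa using hx
    have hy1 : ‖y‖ ≤ 1 := by simpa using hu hy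
    linarith [norm_sub_le x y]
  have h4 : ‖S (x - y)‖ ^ 2 < ε ^ 2 := by
    have := norm_nonneg ((T ∘L S) (x - y))
    nlinarith [norm_nonneg (x - y)]
  exact lt_of_pow_lt_pow_left₀ 2 hε.le h4

/-- The ideal of the compact operators in the C*-algebra `gsioAlgebra`. -/
def compactIdeal : Ideal gsioAlgebra where
  carrier := {T | IsCompactOperator (T : L2 →L[ℂ] L2)}
  add_mem' := fun hS hT => hS.add hT
  zero_mem' := isCompactOperator_zero
  smul_mem' := fun S _ hT => hT.clm_comp (S : L2 →L[ℂ] L2)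

instance instIsTwoSidedCompactIdeal : compactIdeal.IsTwoSided :=
  ⟨fun {_} S hT => IsCompactOperator.comp_clm hT (S : L2 →L[ℂ] L2)⟩

lemma star_mem_compactIdeal {T : gsioAlgebra} (hT : T ∈ compactIdeal) :
    star T ∈ compactIdeal :=
  isCompactOperator_adjoint hT

/-- The involution `π(T)* = π(T*)` of the quotient of `gsioAlgebra` by the compact operators. -/
instance instStarRingQuotient : StarRing (gsioAlgebra ⧸ compactIdeal) where
  star := Quotient.map' star fun S T h => by
    rw [Submodule.quotientRel_def] at h ⊢
    rw [← star_sub]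
    exact star_mem_compactIdeal h
  star_involutive := by
    rintro ⟨S⟩
    exact congrArg (Ideal.Quotient.mk compactIdeal) (star_star S)
  star_mul := by
    rintro ⟨S⟩ ⟨T⟩
    exact congrArg (Ideal.Quotient.mk compactIdeal) (star_mul S T)
  star_add := by
    rintro ⟨S⟩ ⟨T⟩
    exact congrArg (Ideal.Quotient.mk compactIdeal) (star_add S T)

/-! ### Essential range and essential spectrum -/

/-- The essential range of `f`: all `w` such that `{|f - w| < ε}` has positive measure for every
`ε > 0`. -/
def essRange (f : Linf) : Set ℂ :=
  {w | ∀ ε > 0, 0 < arc {θ | ‖f.1 θ - w‖ < ε}}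

/-- The essential spectrum: all `w` such that `T - w I` is not Fredholm. -/
def essSpectrum (T : L2 →L[ℂ] L2) : Set ℂ :=
  {w | ¬ (T - w • (1 : L2 →L[ℂ] L2)).IsFredholm}

end GSIO

end

open GSIO

noncomputable section

namespace GSIO

/-! ### The Poisson kernel at Lebesgue points -/

/-! The proof replaces the radial limits of quadratic forms by a stronger property, `LocallyMul`:
for almost every θ, `T V - a(θ) V` tends to 0 in norm along the unit vectors `V` of a kernel family
as r → 1⁻. Unlike convergence of `⟪V, T V⟫`, this is visibly stable under products, and it implies
the radial limits because the vectors have norm one.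

For multiplication by `f` the property says that the Poisson means of |f - f(θ)|² vanish in the
limit, which holds at Lebesgue points (`ae_tendsto_lintegral_kernelFun_sub`, `locallyMul_mulOp`).
The projections P₊ and P₋ act on each family as the scalars 0 or 1, so `gsio H` has local symbol `H
0 0` on the kernels of H² and `H 1 1` on the conjugate ones. Symbols are contractive in `T`, so the
property survives norm limits (`LocallyMul.exists_of_mem_closure`) and holds on the whole algebra;
uniqueness of limits makes the symbol map a homomorphism.

The kernels tend weakly to 0, so compact operators send them to 0 in norm and have symbol 0; hence
the map descends to the quotient. A Fredholm `T` has a left inverse modulo finite rank, which bounds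
|a| below almost everywhere; applied to `T - c` this gives the essential range inclusion. Finally,
P₊ - z P₊ z̄ is the projection onto the constants, and multiplying it by powers of z yields all
matrix units, hence all compact operators. -/

lemma norm_le_pi_mul_norm_toCircle_sub_one (t : Torus) :
    ‖t‖ ≤ Real.pi / 2 * ‖(AddCircle.toCircle t : ℂ) - 1‖ := by
  obtain ⟨x, hx, rfl⟩ : ∃ x : ℝ, |x| ≤ Real.pi ∧ (x : Torus) = t := by
    obtain ⟨x, hx, rfl⟩ := (AddCircle.coe_image_Ico_eq (2 * Real.pi) (-Real.pi)).symm.subset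
      (Set.mem_univ t)
    exact ⟨x, abs_le.mpr ⟨hx.1, by linarith [hx.2]⟩, rfl⟩
  have hpi := Real.pi_pos
  have h1 : ‖(x : Torus)‖ = |x| := by
    rw [AddCircle.norm_coe_eq_abs_iff _ Real.two_pi_pos.ne', abs_of_pos Real.two_pi_pos]
    linarith
  -- Jordan's inequality at half the angle, since |e^{ix} - 1| = 2 |sin (x/2)|.
  have h2 : 2 / Real.pi * |x / 2| ≤ |Real.sin (x / 2)| :=
    Real.mul_abs_le_abs_sin (by rw [abs_div, abs_two]; linarith)
  have h3 : (AddCircle.toCircle (x : Torus) : ℂ) = Complex.exp (Complex.I * x) := by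
    rw [AddCircle.toCircle_apply_mk, div_self Real.two_pi_pos.ne', one_mul, Circle.coe_exp,
      mul_comm]
  rw [h1, h3, Complex.norm_exp_I_mul_ofReal_sub_one, Real.norm_eq_abs, abs_mul, abs_two]
  rw [abs_div, abs_two, div_mul_eq_mul_div, div_le_iff₀ hpi] at h2
  nlinarith

/-- With w = e^{i(ω-θ)}, the distance |1 - rw| is at least 1 - r, and moving rw to w costs exactly 1
- r, so the chord |w - 1| is at most 2|1 - rw|. The arc is at most π/2 times the chord, and π ≤ 4.
-/
lemma norm_sub_le_norm_one_sub {r : ℝ} (hr0 : 0 ≤ r) (hr1 : r < 1) (θ ω : Torus) :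
    max (1 - r) (‖ω - θ‖ / 4) ≤
      ‖1 - star (radial r θ) * (AddCircle.toCircle ω : ℂ)‖ := by
  have hz : star (radial r θ) * (AddCircle.toCircle ω : ℂ) =
      r * (AddCircle.toCircle (ω - θ) : ℂ) := by
    rw [radial, star_mul', sub_eq_add_neg, AddCircle.toCircle_add, AddCircle.toCircle_neg,
      Circle.coe_mul, Circle.coe_inv_eq_conj]
    simp only [RCLike.star_def, Complex.conj_ofReal]
    ring
  rw [hz]
  set w : ℂ := (AddCircle.toCircle (ω - θ) : ℂ)
  have hw : ‖w‖ = 1 := Circle.norm_coe _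
  have h1 : 1 - r ≤ ‖1 - r * w‖ := by
    have := norm_sub_norm_le (1 : ℂ) (r * w)
    rwa [norm_one, norm_mul, hw, Complex.norm_real, Real.norm_of_nonneg hr0, mul_one] at this
  refine max_le h1 ?_
  have h2 : ‖w - 1‖ ≤ ‖1 - r * w‖ + (1 - r) := by
    have h3 : w - 1 = -(1 - r * w) + (1 - r : ℝ) * w := by push_cast; ring
    calc ‖w - 1‖ ≤ ‖-(1 - r * w)‖ + ‖((1 - r : ℝ) : ℂ) * w‖ := by rw [h3]; exact norm_add_le _ _
      _ = _ := by rw [norm_neg, norm_mul, hw, Complex.norm_real, Real.norm_of_nonneg (by linarith),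
          mul_one]
  have h4 := norm_le_pi_mul_norm_toCircle_sub_one (ω - θ)
  nlinarith [Real.pi_le_four, norm_nonneg (w - 1), Real.pi_pos]

lemma norm_radial {r : ℝ} (hr0 : 0 ≤ r) (θ : Torus) : ‖radial r θ‖ = r := by
  rw [radial, norm_mul, Circle.norm_coe, Complex.norm_real, Real.norm_of_nonneg hr0, mul_one]

lemma norm_kernelFun_sq_le {r : ℝ} (hr0 : 0 ≤ r) (hr1 : r < 1) (θ ω : Torus) :
    ‖kernelFun (radial r θ) ω‖ ^ 2 ≤ 2 * (1 - r) / max (1 - r) (‖ω - θ‖ / 4) ^ 2 := by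
  have h0 : 0 < max (1 - r) (‖ω - θ‖ / 4) := lt_max_of_lt_left (by linarith)
  rw [kernelFun, norm_div, div_pow, norm_radial hr0, Complex.norm_real,
    Real.norm_of_nonneg (Real.sqrt_nonneg _), Real.sq_sqrt (by nlinarith)]
  gcongr
  · nlinarith
  · exact norm_sub_le_norm_one_sub hr0 hr1 θ ω

/-- A dyadic bound of the Poisson kernel by multiples of indicators of balls. -/
lemma enorm_kernelFun_sq_le {r : ℝ} (hr0 : 0 ≤ r) (hr1 : r < 1) (θ ω : Torus) :
    ‖kernelFun (radial r θ) ω‖ₑ ^ 2 ≤ ∑' k : ℕ,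
      (Metric.closedBall θ (2 ^ k * (1 - r))).indicator
        (fun _ => ENNReal.ofReal (128 * (1 / 2) ^ k) / ENNReal.ofReal (2 ^ k * (1 - r))) ω := by
  have hh : 0 < 1 - r := by linarith
  have hex : ∃ k : ℕ, ‖ω - θ‖ ≤ 2 ^ k * (1 - r) := by
    obtain ⟨k, hk⟩ := pow_unbounded_of_one_lt (‖ω - θ‖ / (1 - r)) one_lt_two
    exact ⟨k, ((div_lt_iff₀ hh).mp hk).le⟩
  classical
  -- One term suffices: the least k whose ball contains ω.
  refine le_trans ?_ (ENNReal.le_tsum (Nat.find hex))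
  have hk := Nat.find_spec hex
  have hmin := fun m => Nat.find_min hex (m := m)
  generalize Nat.find hex = k at hk hmin
  rw [Set.indicator_of_mem (by rwa [mem_closedBall_iff_norm]), ← ENNReal.ofReal_div_of_pos
    (by positivity), ← ofReal_norm, ← ENNReal.ofReal_pow (norm_nonneg _)]
  refine ENNReal.ofReal_le_ofReal ((norm_kernelFun_sq_le hr0 hr1 θ ω).trans ?_)
  -- By minimality ω lies outside the ball of half the radius, which gives the factor 8 = 2 · 4;
  -- then 128 = 2 · 8².
  have key : 2 ^ k * (1 - r) ≤ 8 * max (1 - r) (‖ω - θ‖ / 4) := by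
    cases k with
    | zero =>
      have := le_max_left (1 - r) (‖ω - θ‖ / 4)
      simp only [pow_zero, one_mul]
      linarith
    | succ k =>
      have h1 := not_le.mp (hmin k (Nat.lt_succ_self k))
      have := le_max_right (1 - r) (‖ω - θ‖ / 4)
      rw [pow_succ]
      linarith
  rw [div_le_div_iff₀ (by positivity) (by positivity)]
  have h2 : (1 / 2 : ℝ) ^ k * 2 ^ k = 1 := by rw [← mul_pow]; norm_num
  have h4 : (0:ℝ) < 2 ^ k := by positivity
  have h3 := pow_le_pow_left₀ (by positivity) key 2
  calc 2 * (1 - r) * (2 ^ k * (1 - r))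
      = (1 / 2 : ℝ) ^ k * (2 * ((2 ^ k * (1 - r)) ^ 2)) := by
        linear_combination (2 * (1 - r) * (2 ^ k * (1 - r))) * (-h2)
    _ ≤ (1 / 2 : ℝ) ^ k * (2 * ((8 * max (1 - r) (‖ω - θ‖ / 4)) ^ 2)) := by gcongr
    _ = _ := by ring

/-- If the means of `G` over small balls around `θ` tend to zero, so do its Poisson means. -/
lemma tendsto_lintegral_kernelFun {θ : Torus} {G : Torus → ℝ≥0∞} (hG : AEMeasurable G volume)
    {M : ℝ≥0∞} (hM : M ≠ ∞)
    (hbd : ∀ s > 0, (∫⁻ ω in Metric.closedBall θ s, G ω) / ENNReal.ofReal s ≤ M)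
    (hlim : Tendsto (fun s : ℝ => (∫⁻ ω in Metric.closedBall θ s, G ω) / ENNReal.ofReal s)
      (𝓝[>] 0) (𝓝 0)) :
    Tendsto (fun r : ℝ => ∫⁻ ω, ‖kernelFun (radial r θ) ω‖ₑ ^ 2 * G ω) (𝓝[<] 1) (𝓝 0) := by
  set v : ℝ → ℝ≥0∞ := fun s => (∫⁻ ω in Metric.closedBall θ s, G ω) / ENNReal.ofReal s with hv
  have hsum : Tendsto (fun h : ℝ => ∑' k : ℕ, ENNReal.ofReal (128 * (1 / 2) ^ k) * v (2 ^ k * h))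
      (𝓝[>] 0) (𝓝 0) := by
    -- Tannery's theorem: the series is an integral against counting measure, dominated by the
    -- summable sequence 128 · 2⁻ᵏ M.
    simp_rw [← lintegral_count]
    rw [← lintegral_zero (μ := (Measure.count : Measure ℕ))]
    refine tendsto_lintegral_filter_of_dominated_convergence
      (fun k => ENNReal.ofReal (128 * (1 / 2) ^ k) * M) (Eventually.of_forall fun h => by fun_prop)
      ?_ ?_ (ae_of_all _ fun k => ?_)
    · filter_upwards [self_mem_nhdsWithin] with h hh
      refine ae_of_all _ fun k => ?_
      gcongr
      exact hbd _ (mul_pos (by positivity) hh)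
    · rw [lintegral_count, ENNReal.tsum_mul_right]
      refine ENNReal.mul_ne_top ?_ hM
      exact ((summable_geometric_of_lt_one (by norm_num) (by norm_num :
        (1 / 2 : ℝ) < 1)).mul_left 128).tsum_ofReal_ne_top
    · have h1 : Tendsto (fun h : ℝ => 2 ^ k * h) (𝓝[>] 0) (𝓝[>] 0) := by
        refine tendsto_nhdsWithin_iff.mpr ⟨?_, ?_⟩
        · have : Tendsto (fun h : ℝ => 2 ^ k * h) (𝓝 0) (𝓝 (2 ^ k * 0)) :=
            tendsto_id.const_mul _
          rw [mul_zero] at this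
          exact this.mono_left nhdsWithin_le_nhds
        · filter_upwards [self_mem_nhdsWithin] with h hh
          exact mul_pos (by positivity : (0 : ℝ) < 2 ^ k) hh
      have h2 := ENNReal.Tendsto.const_mul (a := ENNReal.ofReal (128 * (1 / 2) ^ k))
        (hlim.comp h1) (Or.inr ENNReal.ofReal_ne_top)
      rwa [mul_zero] at h2
  have hr : Tendsto (fun r : ℝ => 1 - r) (𝓝[<] 1) (𝓝[>] 0) := by
    refine tendsto_nhdsWithin_iff.mpr ⟨?_, ?_⟩
    · have : Tendsto (fun r : ℝ => 1 - r) (𝓝 1) (𝓝 (1 - 1)) := tendsto_const_nhds.sub tendsto_id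
      rw [sub_self] at this
      exact this.mono_left nhdsWithin_le_nhds
    · filter_upwards [self_mem_nhdsWithin] with r hr
      exact sub_pos.mpr (Set.mem_Iio.mp hr)
  refine tendsto_of_tendsto_of_tendsto_of_le_of_le' tendsto_const_nhds (hsum.comp hr)
    (Eventually.of_forall fun _ => zero_le) ?_
  filter_upwards [Ioo_mem_nhdsLT (zero_lt_one (α := ℝ))] with r hr'
  calc ∫⁻ ω, ‖kernelFun (radial r θ) ω‖ₑ ^ 2 * G ω
      ≤ ∫⁻ ω, ∑' k : ℕ, (Metric.closedBall θ (2 ^ k * (1 - r))).indicator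
        (fun _ => ENNReal.ofReal (128 * (1 / 2) ^ k) / ENNReal.ofReal (2 ^ k * (1 - r))) ω
          * G ω := by
        refine lintegral_mono fun ω => ?_
        rw [ENNReal.tsum_mul_right]
        gcongr
        exact enorm_kernelFun_sq_le hr'.1.le hr'.2 θ ω
    _ = ∑' k : ℕ, ∫⁻ ω, (Metric.closedBall θ (2 ^ k * (1 - r))).indicator
        (fun _ => ENNReal.ofReal (128 * (1 / 2) ^ k) / ENNReal.ofReal (2 ^ k * (1 - r))) ω
          * G ω := lintegral_tsum fun k => AEMeasurable.mul
            (measurable_const.indicator Metric.isClosed_closedBall.measurableSet).aemeasurable hG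
    _ = ∑' k : ℕ, ENNReal.ofReal (128 * (1 / 2) ^ k) * v (2 ^ k * (1 - r)) := by
        congr 1
        funext k
        simp_rw [hv, ← Set.indicator_mul_left]
        rw [lintegral_indicator Metric.isClosed_closedBall.measurableSet,
          lintegral_const_mul'' _ hG.restrict]
        simp only [div_eq_mul_inv]
        ring
    _ = _ := rfl

lemma exists_ae_enorm_le (f : Linf) : ∃ C : ℝ≥0∞, C ≠ ∞ ∧ ∀ᵐ ω ∂arc, ‖f.1 ω‖ₑ ≤ C := by
  refine ⟨eLpNorm f.1 ∞ arc, (Lp.eLpNorm_ne_top (toLpTop f)), ?_⟩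
  rw [eLpNorm_exponent_top]
  exact enorm_ae_le_eLpNormEssSup _ _

lemma volume_eq_smul_arc : (volume : Measure Torus) = ENNReal.ofReal (2 * Real.pi) • arc :=
  AddCircle.volume_eq_smul_haarAddCircle

lemma ofReal_two_pi_ne_zero : ENNReal.ofReal (2 * Real.pi) ≠ 0 := by
  simpa using Real.pi_pos

lemma ae_volume_iff {p : Torus → Prop} : (∀ᵐ ω ∂(volume : Measure Torus), p ω) ↔ ∀ᵐ ω ∂arc, p ω := by
  rw [volume_eq_smul_arc, Measure.ae_ennreal_smul_measure_iff ofReal_two_pi_ne_zero]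

/-- At almost every point `θ` the Poisson means of `|f - f(θ)|²` tend to zero. -/
lemma ae_tendsto_lintegral_kernelFun_sub (f : Linf) :
    ∀ᵐ θ ∂arc, Tendsto (fun r : ℝ => ∫⁻ ω, ‖kernelFun (radial r θ) ω‖ₑ ^ 2 * ‖f.1 ω - f.1 θ‖ₑ ^ 2 ∂arc)
      (𝓝[<] 1) (𝓝 0) := by
  obtain ⟨C, hC, hfC⟩ := exists_ae_enorm_le f
  have hmeas : AEStronglyMeasurable f.1 (volume : Measure Torus) := by
    rw [volume_eq_smul_arc]
    exact f.1.aestronglyMeasurable.smul_measure _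
  have hint : LocallyIntegrable f.1 (volume : Measure Torus) := by
    refine Integrable.locallyIntegrable ?_
    rw [volume_eq_smul_arc]
    exact ((Lp.memLp (toLpTop f)).integrable le_top).smul_measure ENNReal.ofReal_ne_top
  have hleb := (IsUnifLocDoublingMeasure.vitaliFamily
    (volume : Measure Torus) 1).ae_tendsto_lintegral_enorm_sub_div hint
  rw [ae_volume_iff] at hleb
  filter_upwards [hleb, hfC] with θ hθ hθC
  have hball : ∀ s : ℝ, volume (Metric.closedBall θ s) ≤ 2 * ENNReal.ofReal s := fun s => by
    rw [AddCircle.volume_closedBall, ← ENNReal.ofReal_ofNat 2, ← ENNReal.ofReal_mul zero_le_two]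
    exact ENNReal.ofReal_le_ofReal (min_le_right _ _)
  have hG : ∀ᵐ ω ∂(volume : Measure Torus), ‖f.1 ω - f.1 θ‖ₑ ≤ C + C := by
    rw [ae_volume_iff]
    filter_upwards [hfC] with ω hω
    exact (enorm_sub_le).trans (add_le_add hω hθC)
  have hGm : AEMeasurable (fun ω => ‖f.1 ω - f.1 θ‖ₑ ^ 2) (volume : Measure Torus) :=
    ((hmeas.sub aestronglyMeasurable_const).enorm).pow_const 2
  have hCC : C + C ≠ ∞ := ENNReal.add_ne_top.mpr ⟨hC, hC⟩
  -- Boundedness reduces the square to the first power, |f - f(θ)|² ≤ 2C |f - f(θ)|, and a ball of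
  -- radius s has volume at most 2s, so the Lebesgue point property in L¹ is enough.
  have hle : ∀ s : ℝ, (∫⁻ ω in Metric.closedBall θ s, ‖f.1 ω - f.1 θ‖ₑ ^ 2) / ENNReal.ofReal s ≤
      (C + C) * 2 * ((∫⁻ ω in Metric.closedBall θ s, ‖f.1 ω - f.1 θ‖ₑ) /
        volume (Metric.closedBall θ s)) := fun s => by
    calc _ ≤ ((C + C) * ∫⁻ ω in Metric.closedBall θ s, ‖f.1 ω - f.1 θ‖ₑ) / ENNReal.ofReal s := by
          rw [← lintegral_const_mul' _ _ hCC]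
          gcongr 1
          refine lintegral_mono_ae (ae_restrict_of_ae ?_)
          filter_upwards [hG] with ω hω
          rw [sq]
          gcongr
      _ ≤ ((C + C) * ∫⁻ ω in Metric.closedBall θ s, ‖f.1 ω - f.1 θ‖ₑ) /
          (volume (Metric.closedBall θ s) / 2) := by
          gcongr
          exact ENNReal.div_le_of_le_mul' (hball s)
      _ = _ := by
          rw [div_eq_mul_inv, div_eq_mul_inv, div_eq_mul_inv, ENNReal.mul_inv (by simp) (by simp),
            inv_inv]
          ring
  have key := tendsto_lintegral_kernelFun (θ := θ) hGm (M := (C + C) * 2 * (C + C))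
    (by finiteness) ?_ ?_
  -- Differentiation was done for `volume`; the factor 2π is now divided out.
  · rw [volume_eq_smul_arc] at key
    simp_rw [lintegral_smul_measure, smul_eq_mul] at key
    have := ENNReal.Tendsto.const_mul (a := (ENNReal.ofReal (2 * Real.pi))⁻¹) key
      (Or.inr (ENNReal.inv_ne_top.mpr ofReal_two_pi_ne_zero))
    simpa only [← mul_assoc, ENNReal.inv_mul_cancel ofReal_two_pi_ne_zero ENNReal.ofReal_ne_top,
      one_mul, mul_zero] using this
  · intro s _
    refine (hle s).trans ?_
    gcongr
    refine ENNReal.div_le_of_le_mul ?_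
    calc _ ≤ ∫⁻ ω in Metric.closedBall θ s, (C + C) :=
          lintegral_mono_ae (ae_restrict_of_ae hG)
      _ = _ := by rw [setLIntegral_const]
  · have h1 : Tendsto (fun s : ℝ => Metric.closedBall θ s) (𝓝[>] 0)
        ((IsUnifLocDoublingMeasure.vitaliFamily (volume : Measure Torus) 1).filterAt θ) := by
      refine IsUnifLocDoublingMeasure.tendsto_closedBall_filterAt _ (fun _ => θ) _ tendsto_id ?_
      filter_upwards [self_mem_nhdsWithin] with s hs
      exact Metric.mem_closedBall_self (by simpa using (Set.mem_Ioi.mp hs).le)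
    have h2 := ENNReal.Tendsto.const_mul (a := (C + C) * 2) (hθ.comp h1)
      (Or.inr (by finiteness))
    rw [mul_zero] at h2
    exact tendsto_of_tendsto_of_tendsto_of_le_of_le tendsto_const_nhds h2 (fun _ => zero_le) hle

/-! ### Local action on the kernels -/

/-- For almost every `θ`, `T` acts on the vectors `V (r e^{iθ})` asymptotically, as `r → 1⁻`, as
multiplication by the number `a θ`. -/
def LocallyMul (V : ℂ → L2) (T : L2 →L[ℂ] L2) (a : Linf) : Prop :=
  ∀ᵐ θ ∂arc, Tendsto (fun r : ℝ => T (V (radial r θ)) - a.1 θ • V (radial r θ)) (𝓝[<] 1) (𝓝 0)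

lemma coeFn_mulOp (f : Linf) (v : L2) : mulOp f v =ᵐ[arc] fun ω => f.1 ω * v ω :=
  (ContinuousLinearMap.mul ℂ ℂ).coeFn_holder (toLpTop f) v

lemma coeFn_kernelPlus (z : ℂ) : kernelPlus z =ᵐ[arc] kernelFun z :=
  ContinuousMap.coeFn_toLp arc _

lemma coeFn_kernelMinus (z : ℂ) : kernelMinus z =ᵐ[arc]
    fun θ => star (AddCircle.toCircle θ : ℂ) * star (kernelFun z θ) :=
  ContinuousMap.coeFn_toLp arc _

lemma enorm_kernelPlus (z : ℂ) : ∀ᵐ ω ∂arc, ‖kernelPlus z ω‖ₑ = ‖kernelFun z ω‖ₑ := by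
  filter_upwards [coeFn_kernelPlus z] with ω h
  rw [h]

lemma enorm_kernelMinus (z : ℂ) : ∀ᵐ ω ∂arc, ‖kernelMinus z ω‖ₑ = ‖kernelFun z ω‖ₑ := by
  filter_upwards [coeFn_kernelMinus z] with ω h
  rw [h, ← ofReal_norm, ← ofReal_norm, norm_mul, norm_star, norm_star, Circle.norm_coe, one_mul]

/-- The squared norm of (f - f(θ)) V is the Poisson mean of |f - f(θ)|². Only the modulus of `V`
enters, so both kernel families are covered. -/
lemma locallyMul_mulOp {V : ℂ → L2} (hV : ∀ z, ∀ᵐ ω ∂arc, ‖V z ω‖ₑ = ‖kernelFun z ω‖ₑ)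
    (f : Linf) : LocallyMul V (mulOp f) f := by
  filter_upwards [ae_tendsto_lintegral_kernelFun_sub f] with θ hθ
  rw [tendsto_iff_norm_sub_tendsto_zero]
  have h1 : ∀ r : ℝ, ‖mulOp f (V (radial r θ)) - f.1 θ • V (radial r θ)‖ₑ ^ 2 =
      ∫⁻ ω, ‖kernelFun (radial r θ) ω‖ₑ ^ 2 * ‖f.1 ω - f.1 θ‖ₑ ^ 2 ∂arc := fun r => by
    rw [Lp.enorm_def, eLpNorm_eq_lintegral_rpow_enorm_toReal two_ne_zero ENNReal.ofNat_ne_top,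
      ← ENNReal.rpow_natCast, ← ENNReal.rpow_mul]
    simp only [ENNReal.toReal_ofNat, Nat.cast_ofNat, one_div, ne_eq, OfNat.ofNat_ne_zero,
      not_false_eq_true, inv_mul_cancel₀, ENNReal.rpow_one]
    refine lintegral_congr_ae ?_
    filter_upwards [hV (radial r θ), coeFn_mulOp f (V (radial r θ)),
      Lp.coeFn_sub (mulOp f (V (radial r θ))) (f.1 θ • V (radial r θ)),
      Lp.coeFn_smul (f.1 θ) (V (radial r θ))] with ω h1 h2 h3 h4
    rw [h3, Pi.sub_apply, h2, h4, Pi.smul_apply, smul_eq_mul, ← sub_mul, enorm_mul, h1,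
      ENNReal.rpow_ofNat, mul_pow, mul_comm]
  simp_rw [← h1] at hθ
  have h2 := (ENNReal.tendsto_toReal ENNReal.zero_ne_top).comp hθ
  simp only [Function.comp_def, ENNReal.toReal_pow, toReal_enorm, ENNReal.toReal_zero] at h2
  have h3 := h2.sqrt
  simpa [Real.sqrt_sq] using h3

/-! ### Fourier series of the kernels -/

/-- The Fourier exponential `z ^ n` as a vector of `L²`. -/
abbrev expVec (n : ℤ) : L2 := fourierLp 2 n

/-- The vectors `V z` have the expansion `√(1 - |z|²) ∑ (w z) ^ n e_{m n}` with `|w z| = |z|`. -/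
def IsKernelFamily (V : ℂ → L2) (m : ℕ → ℤ) (w : ℂ → ℂ) : Prop :=
  Function.Injective m ∧ (∀ z, ‖w z‖ = ‖z‖) ∧ ∀ z, ‖z‖ < 1 →
    HasSum (fun n : ℕ => ((Real.sqrt (1 - ‖z‖ ^ 2) : ℂ) * w z ^ n) • expVec (m n)) (V z)

/-- Geometric decay makes the series converge uniformly on the circle, and the inclusion of
continuous functions in L² is continuous. -/
lemma hasSum_toLp {c w : ℂ} (hw : ‖w‖ < 1) (m : ℕ → ℤ) (F : C(Torus, ℂ))
    (hF : ∀ ω, HasSum (fun n : ℕ => (c * w ^ n) * fourier (m n) ω) (F ω)) :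
    HasSum (fun n : ℕ => (c * w ^ n) • expVec (m n)) (ContinuousMap.toLp (E := ℂ) 2 arc ℂ F) := by
  have h1 : Summable fun n : ℕ => (c * w ^ n) • (fourier (m n) : C(Torus, ℂ)) := by
    refine Summable.of_norm ?_
    simp_rw [norm_smul, fourier_norm, mul_one, norm_mul, norm_pow]
    exact (summable_geometric_of_lt_one (norm_nonneg _) hw).mul_left _
  have h2 : HasSum (fun n : ℕ => (c * w ^ n) • (fourier (m n) : C(Torus, ℂ))) F := by
    convert h1.hasSum using 1
    ext ω
    refine (hF ω).unique ?_
    simpa using ContinuousMap.hasSum_apply h1.hasSum ω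
  simpa using h2.mapL (ContinuousMap.toLp (E := ℂ) 2 arc ℂ)

lemma isKernelFamily_kernelPlus : IsKernelFamily kernelPlus (fun n => (n : ℤ)) star := by
  refine ⟨Nat.cast_injective, norm_star, fun z hz => hasSum_toLp (by rwa [norm_star]) _ _ fun ω => ?_⟩
  have h : ‖star z * (AddCircle.toCircle ω : ℂ)‖ < 1 := by
    rwa [norm_mul, norm_star, Circle.norm_coe, mul_one]
  have := (hasSum_geometric_of_norm_lt_one h).mul_left (Real.sqrt (1 - ‖z‖ ^ 2) : ℂ)
  convert this using 2 with n
  · rfl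
  · rw [fourier_apply, natCast_zsmul, AddCircle.toCircle_nsmul, mul_pow, Circle.coe_pow]
    ring
  · exact div_eq_mul_inv _ _

/-- The extra factor ω̄ starts the exponents at -1, so no Fourier mode of H² occurs. -/
lemma isKernelFamily_kernelMinus :
    IsKernelFamily kernelMinus (fun n => -((n : ℤ) + 1)) id := by
  refine ⟨fun a b h => by simpa using h, fun _ => rfl, fun z hz => hasSum_toLp hz _ _ fun ω => ?_⟩
  have h : ‖z * star (AddCircle.toCircle ω : ℂ)‖ < 1 := by
    rwa [norm_mul, norm_star, Circle.norm_coe, mul_one]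
  have := (hasSum_geometric_of_norm_lt_one h).mul_left
    (star (AddCircle.toCircle ω : ℂ) * (Real.sqrt (1 - ‖z‖ ^ 2) : ℂ))
  convert this using 2 with n
  · rfl
  · rw [fourier_apply, neg_smul, AddCircle.toCircle_neg, Circle.coe_inv_eq_conj]
    have : ((n : ℤ) + 1) • ω = (n + 1) • ω := by
      rw [← natCast_zsmul]; push_cast; rfl
    rw [this, AddCircle.toCircle_nsmul, Circle.coe_pow, map_pow, mul_pow, pow_succ]
    simp only [RCLike.star_def]
    ring
  · change star (AddCircle.toCircle ω : ℂ) * star (kernelFun z ω) = _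
    simp [kernelFun, div_eq_mul_inv, mul_assoc]

lemma inner_expVec (i j : ℤ) : ⟪expVec i, expVec j⟫_ℂ = if i = j then 1 else 0 :=
  orthonormal_iff_ite.mp orthonormal_fourier i j

namespace IsKernelFamily

variable {V : ℂ → L2} {m : ℕ → ℤ} {w : ℂ → ℂ}

lemma inner_expVec_apply (h : IsKernelFamily V m w) {z : ℂ} (hz : ‖z‖ < 1) (n : ℕ) :
    ⟪expVec (m n), V z⟫_ℂ = (Real.sqrt (1 - ‖z‖ ^ 2) : ℂ) * w z ^ n := by
  have h1 := (h.2.2 z hz).mapL (innerSL ℂ (expVec (m n)))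
  refine h1.unique ?_
  convert hasSum_single n fun k hk => ?_ using 1
  · rw [innerSL_apply_apply, inner_smul_right, inner_expVec, if_pos rfl, mul_one]
  · rw [innerSL_apply_apply, inner_smul_right, inner_expVec, if_neg fun e => hk (h.1 e).symm,
      mul_zero]

lemma inner_expVec_of_notMem (h : IsKernelFamily V m w) {z : ℂ} (hz : ‖z‖ < 1) {j : ℤ}
    (hj : ∀ n, m n ≠ j) : ⟪expVec j, V z⟫_ℂ = 0 := by
  have h1 := (h.2.2 z hz).mapL (innerSL ℂ (expVec j))
  refine h1.unique ?_
  convert hasSum_zero using 2 with n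
  rw [innerSL_apply_apply, inner_smul_right, inner_expVec, if_neg fun e => hj n e.symm, mul_zero]

lemma norm_eq_one (h : IsKernelFamily V m w) {z : ℂ} (hz : ‖z‖ < 1) : ‖V z‖ = 1 := by
  have h1 := (h.2.2 z hz).mapL (innerSL ℂ (V z))
  have hpos : 0 < 1 - ‖z‖ ^ 2 := by nlinarith [norm_nonneg z]
  have h2 : HasSum (fun n : ℕ => ((1 - ‖z‖ ^ 2 : ℝ) : ℂ) * ((‖z‖ ^ 2 : ℝ) : ℂ) ^ n) 1 := by
    have hlt : ‖((‖z‖ ^ 2 : ℝ) : ℂ)‖ < 1 := by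
      rw [Complex.norm_real, Real.norm_of_nonneg (by positivity)]
      linarith
    have := (hasSum_geometric_of_norm_lt_one hlt).mul_left ((1 - ‖z‖ ^ 2 : ℝ) : ℂ)
    have hne : (1 : ℂ) - ((‖z‖ ^ 2 : ℝ) : ℂ) ≠ 0 := by
      rw [← Complex.ofReal_one, ← Complex.ofReal_sub]
      exact Complex.ofReal_ne_zero.mpr hpos.ne'
    rwa [Complex.ofReal_sub, Complex.ofReal_one, mul_inv_cancel₀ hne, ← Complex.ofReal_one,
      ← Complex.ofReal_sub] at this
  have h3 : ⟪V z, V z⟫_ℂ = 1 := by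
    refine h1.unique ?_
    convert h2 using 2 with n
    · rfl
    · rw [innerSL_apply_apply, inner_smul_right, ← inner_conj_symm, h.inner_expVec_apply hz,
        Complex.mul_conj, Complex.normSq_eq_norm_sq, norm_mul, norm_pow, h.2.1, Complex.norm_real,
        Real.norm_of_nonneg (Real.sqrt_nonneg _), mul_pow, Real.sq_sqrt hpos.le]
      push_cast
      ring
  rw [inner_self_eq_norm_sq_to_K] at h3
  have h4 : ‖V z‖ ^ 2 = 1 := Complex.ofReal_injective (by simpa using h3)
  nlinarith [norm_nonneg (V z)]

/-- Every Fourier coefficient is bounded by the normalising factor √(1 - r²). -/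
lemma tendsto_inner_expVec (h : IsKernelFamily V m w) (j : ℤ) (θ : Torus) :
    Tendsto (fun r : ℝ => ⟪expVec j, V (radial r θ)⟫_ℂ) (𝓝[<] 1) (𝓝 0) := by
  have hc : Tendsto (fun r : ℝ => Real.sqrt (1 - r ^ 2)) (𝓝[<] 1) (𝓝 0) := by
    have : Tendsto (fun r : ℝ => Real.sqrt (1 - r ^ 2)) (𝓝 1) (𝓝 (Real.sqrt (1 - 1 ^ 2))) :=
      Continuous.tendsto (by fun_prop) 1
    simp only [one_pow, sub_self, Real.sqrt_zero] at this
    exact this.mono_left nhdsWithin_le_nhds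
  refine squeeze_zero_norm' ?_ hc
  filter_upwards [Ioo_mem_nhdsLT (zero_lt_one (α := ℝ))] with r hr
  have hz := norm_radial hr.1.le θ
  have hz1 : ‖radial r θ‖ < 1 := hz.trans_lt hr.2
  by_cases hj : ∃ n, m n = j
  · obtain ⟨n, rfl⟩ := hj
    rw [h.inner_expVec_apply hz1, norm_mul, norm_pow, h.2.1, hz, Complex.norm_real,
      Real.norm_of_nonneg (Real.sqrt_nonneg _)]
    exact mul_le_of_le_one_right (Real.sqrt_nonneg _) (pow_le_one₀ hr.1.le hr.2.le)
  · rw [h.inner_expVec_of_notMem hz1 (not_exists.mp hj), norm_zero]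
    exact Real.sqrt_nonneg _

lemma mem_of_isClosed (h : IsKernelFamily V m w) {z : ℂ} (hz : ‖z‖ < 1) {W : Submodule ℂ L2}
    (hW : IsClosed (W : Set L2)) (hm : ∀ n, expVec (m n) ∈ W) : V z ∈ W :=
  hW.mem_of_tendsto (h.2.2 z hz) (Eventually.of_forall fun _ =>
    W.sum_mem fun n _ => W.smul_mem _ (hm n))

end IsKernelFamily

lemma expVec_natCast_mem_H2 (n : ℕ) : expVec n ∈ H2 :=
  Submodule.le_topologicalClosure _ (Submodule.subset_span ⟨n, rfl⟩)

lemma expVec_mem_H2_orthogonal {j : ℤ} (hj : j < 0) : expVec j ∈ H2ᗮ := by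
  rw [H2, Submodule.orthogonal_closure, Submodule.mem_orthogonal]
  intro u hu
  induction hu using Submodule.span_induction with
  | mem x hx =>
    obtain ⟨n, rfl⟩ := hx
    rw [inner_expVec, if_neg (by omega)]
  | zero => exact inner_zero_left _
  | add x y _ _ hx hy => rw [inner_add_left, hx, hy, add_zero]
  | smul a x _ hx => rw [inner_smul_left, hx, mul_zero]

lemma Pplus_apply_of_mem {v : L2} (hv : v ∈ H2) : Pplus v = v :=
  Submodule.starProjection_eq_self_iff.mpr hv

lemma Pplus_apply_of_mem_orthogonal {v : L2} (hv : v ∈ H2ᗮ) : Pplus v = 0 :=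
  (Submodule.starProjection_apply_eq_zero_iff _).mpr hv

lemma Pplus_kernelPlus {z : ℂ} (hz : ‖z‖ < 1) : Pplus (kernelPlus z) = kernelPlus z :=
  Pplus_apply_of_mem <| isKernelFamily_kernelPlus.mem_of_isClosed hz
    (Submodule.isClosed_topologicalClosure _) expVec_natCast_mem_H2

lemma Pplus_kernelMinus {z : ℂ} (hz : ‖z‖ < 1) : Pplus (kernelMinus z) = 0 :=
  Pplus_apply_of_mem_orthogonal <| isKernelFamily_kernelMinus.mem_of_isClosed hz
    (Submodule.isClosed_orthogonal _) fun n => expVec_mem_H2_orthogonal (by omega)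

/-! ### The algebra of locally multiplicative operators -/

lemma eventually_norm_radial_lt_one (θ : Torus) : ∀ᶠ r : ℝ in 𝓝[<] 1, ‖radial r θ‖ < 1 := by
  filter_upwards [Ioo_mem_nhdsLT (zero_lt_one (α := ℝ))] with r hr
  exact (norm_radial hr.1.le θ).trans_lt hr.2

namespace LocallyMul

variable {V : ℂ → L2} {S T : L2 →L[ℂ] L2} {a b : Linf}

lemma add (hS : LocallyMul V S a) (hT : LocallyMul V T b) : LocallyMul V (S + T) (a + b) := by
  filter_upwards [hS, hT, AEEqFun.coeFn_add a.1 b.1] with θ h1 h2 h3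
  have h := h1.add h2
  rw [add_zero] at h
  refine h.congr fun r => ?_
  have h4 : (a + b).1 θ = a.1 θ + b.1 θ := h3
  rw [h4, _root_.add_apply, add_smul]
  abel

/-- Split STV - abV = S(TV - bV) + b(SV - aV); this is where norm convergence is needed. -/
lemma mul (hS : LocallyMul V S a) (hT : LocallyMul V T b) : LocallyMul V (S * T) (a * b) := by
  filter_upwards [hS, hT, AEEqFun.coeFn_mul a.1 b.1] with θ h1 h2 h3
  have h := ((S.continuous.tendsto 0).comp h2).add (h1.const_smul (b.1 θ))
  rw [map_zero, smul_zero, add_zero] at h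
  refine h.congr fun r => ?_
  have h4 : (a * b).1 θ = a.1 θ * b.1 θ := h3
  rw [h4, mul_apply_eq_comp, Function.comp_apply, map_sub, map_smul, smul_sub,
    mul_comm (a.1 θ), mul_smul]
  abel

lemma coeFn_algebraMap (c : ℂ) : ∀ᵐ θ ∂arc, (algebraMap ℂ Linf c).1 θ = c := by
  have h : (algebraMap ℂ Linf c).1 = c • (1 : Torus →ₘ[arc] ℂ) :=
    Algebra.algebraMap_eq_smul_one c
  filter_upwards [AEEqFun.coeFn_smul c (1 : Torus →ₘ[arc] ℂ),
    AEEqFun.coeFn_one (α := Torus) (β := ℂ) (μ := arc)] with θ h1 h2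
  rw [h, h1, Pi.smul_apply, h2, Pi.one_apply, smul_eq_mul, mul_one]

lemma of_eventually_eq_smul (c : ℂ)
    (h : ∀ z, ‖z‖ < 1 → T (V z) = c • V z) : LocallyMul V T (algebraMap ℂ Linf c) := by
  filter_upwards [coeFn_algebraMap c] with θ hθ
  refine tendsto_const_nhds.congr' ?_
  filter_upwards [eventually_norm_radial_lt_one θ] with r hr
  rw [h _ hr, hθ, sub_self]

lemma scalar (c : ℂ) : LocallyMul V (algebraMap ℂ (L2 →L[ℂ] L2) c) (algebraMap ℂ Linf c) :=
  of_eventually_eq_smul c fun z _ => by rw [ContinuousLinearMap.algebraMap_apply]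

/-- The vectors are eigenvectors of P₊ and P₋ with eigenvalues p and 1 - p. Taking p = 1 selects `H
0 0`, and p = 0 selects `H 1 1`. -/
lemma of_gsio {p : ℂ} (hV : ∀ z, ∀ᵐ ω ∂arc, ‖V z ω‖ₑ = ‖kernelFun z ω‖ₑ)
    (hp : ∀ z, ‖z‖ < 1 → Pplus (V z) = p • V z) (H : Matrix (Fin 2) (Fin 2) Linf) :
    LocallyMul V (gsio H) (p ^ 2 • H 0 0 + ((1 - p) * p) • H 1 0 + (p * (1 - p)) • H 0 1
      + (1 - p) ^ 2 • H 1 1) := by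
  have h1 : LocallyMul V Pplus (algebraMap ℂ Linf p) := of_eventually_eq_smul p hp
  have h2 : LocallyMul V Pminus (algebraMap ℂ Linf (1 - p)) :=
    of_eventually_eq_smul _ fun z hz => by
      rw [Pminus, _root_.sub_apply, hp z hz, sub_smul, one_smul,
        one_apply_eq_self]
  have hm := locallyMul_mulOp hV
  have := (((h1.mul (hm (H 0 0))).mul h1).add ((h2.mul (hm (H 1 0))).mul h1)).add
    ((h1.mul (hm (H 0 1))).mul h2) |>.add ((h2.mul (hm (H 1 1))).mul h2)
  have e : p ^ 2 • H 0 0 + ((1 - p) * p) • H 1 0 + (p * (1 - p)) • H 0 1 + (1 - p) ^ 2 • H 1 1 =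
      algebraMap ℂ Linf p * H 0 0 * algebraMap ℂ Linf p
      + algebraMap ℂ Linf (1 - p) * H 1 0 * algebraMap ℂ Linf p
      + algebraMap ℂ Linf p * H 0 1 * algebraMap ℂ Linf (1 - p)
      + algebraMap ℂ Linf (1 - p) * H 1 1 * algebraMap ℂ Linf (1 - p) := by
    simp only [Algebra.smul_def, map_mul, map_pow]
    ring
  rw [e]
  exact this

end LocallyMul

lemma locallyMul_kernelPlus_gsio (H : Matrix (Fin 2) (Fin 2) Linf) :
    LocallyMul kernelPlus (gsio H) (H 0 0) := by
  simpa using LocallyMul.of_gsio (p := 1) enorm_kernelPlus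
    (fun z hz => by rw [Pplus_kernelPlus hz, one_smul]) H

lemma locallyMul_kernelMinus_gsio (H : Matrix (Fin 2) (Fin 2) Linf) :
    LocallyMul kernelMinus (gsio H) (H 1 1) := by
  simpa using LocallyMul.of_gsio (p := 0) enorm_kernelMinus
    (fun z hz => by rw [Pplus_kernelMinus hz, zero_smul]) H

namespace LocallyMul

variable {V : ℂ → L2} {m : ℕ → ℤ} {w : ℂ → ℂ} {S T : L2 →L[ℂ] L2} {a b : Linf}

lemma tendsto_inner (hV : IsKernelFamily V m w) (hT : LocallyMul V T a) : ∀ᵐ θ ∂arc,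
    Tendsto (fun r : ℝ => ⟪V (radial r θ), T (V (radial r θ))⟫_ℂ) (𝓝[<] 1) (𝓝 (a.1 θ)) := by
  filter_upwards [hT] with θ h
  rw [tendsto_iff_norm_sub_tendsto_zero]
  refine squeeze_zero' (Eventually.of_forall fun _ => norm_nonneg _) ?_
    (tendsto_zero_iff_norm_tendsto_zero.mp h)
  filter_upwards [eventually_norm_radial_lt_one θ] with r hr
  have h1 := hV.norm_eq_one hr
  have h2 : ⟪V (radial r θ), T (V (radial r θ)) - a.1 θ • V (radial r θ)⟫_ℂ =
      ⟪V (radial r θ), T (V (radial r θ))⟫_ℂ - a.1 θ := by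
    rw [inner_sub_right, inner_smul_right, inner_self_eq_norm_sq_to_K, h1]
    simp
  rw [← h2]
  simpa [h1] using norm_inner_le_norm (𝕜 := ℂ) (V (radial r θ))
    (T (V (radial r θ)) - a.1 θ • V (radial r θ))

lemma tendsto_norm (hV : IsKernelFamily V m w) (hT : LocallyMul V T a) : ∀ᵐ θ ∂arc,
    Tendsto (fun r : ℝ => ‖T (V (radial r θ))‖) (𝓝[<] 1) (𝓝 ‖a.1 θ‖) := by
  filter_upwards [hT] with θ h
  rw [tendsto_iff_norm_sub_tendsto_zero]
  refine squeeze_zero' (Eventually.of_forall fun _ => norm_nonneg _) ?_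
    (tendsto_zero_iff_norm_tendsto_zero.mp h)
  filter_upwards [eventually_norm_radial_lt_one θ] with r hr
  have h1 : ‖a.1 θ • V (radial r θ)‖ = ‖a.1 θ‖ := by rw [norm_smul, hV.norm_eq_one hr, mul_one]
  rw [← h1, Real.norm_eq_abs]
  exact abs_norm_sub_norm_le _ _

/-- Contractivity of the symbol, which makes the symbols of a norm convergent sequence Cauchy in
L^∞. -/
lemma ae_norm_le (hV : IsKernelFamily V m w) (hT : LocallyMul V T a) :
    ∀ᵐ θ ∂arc, ‖a.1 θ‖ ≤ ‖T‖ := by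
  filter_upwards [hT.tendsto_norm hV] with θ h
  refine le_of_tendsto h ?_
  filter_upwards [eventually_norm_radial_lt_one θ] with r hr
  simpa [hV.norm_eq_one hr] using T.le_opNorm (V (radial r θ))

lemma sub (hS : LocallyMul V S a) (hT : LocallyMul V T b) : LocallyMul V (S - T) (a - b) := by
  have h := hS.add ((LocallyMul.scalar (V := V) (-1)).mul hT)
  simpa [sub_eq_add_neg] using h

/-- The operators acting locally as multiplications form a closed set. -/
lemma exists_of_mem_closure (hV : IsKernelFamily V m w) {A : Set (L2 →L[ℂ] L2)}
    (hA : ∀ T ∈ A, ∃ a, LocallyMul V T a) (hT : T ∈ closure A) : ∃ a, LocallyMul V T a := by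
  obtain ⟨u, hu, hlim⟩ := mem_closure_iff_seq_limit.mp hT
  choose a ha using fun n => hA (u n) (hu n)
  have hnorm : ∀ i j, ‖toLpTop (a i) - toLpTop (a j)‖ ≤ ‖u i - u j‖ := fun i j => by
    have h1 := ((ha i).sub (ha j)).ae_norm_le hV
    have h2 := Lp.norm_le_of_ae_bound (f := toLpTop (a i - a j)) (norm_nonneg (u i - u j)) h1
    have h3 : ‖toLpTop (a i - a j)‖ ≤ ‖u i - u j‖ := by simpa using h2
    exact h3
  have hc : CauchySeq fun n => toLpTop (a n) := by
    rw [Metric.cauchySeq_iff']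
    intro ε hε
    obtain ⟨N, hN⟩ := Metric.cauchySeq_iff'.mp hlim.cauchySeq ε hε
    refine ⟨N, fun n hn => ?_⟩
    have := hN n hn
    rw [dist_eq_norm] at this ⊢
    exact (hnorm n N).trans_lt this
  obtain ⟨g, hg⟩ := cauchySeq_tendsto_of_complete hc
  refine ⟨⟨g.1, g.2⟩, ?_⟩
  -- One null set serves all n, so n may be chosen after θ in the ε/3 argument.
  have h1 : ∀ᵐ θ ∂arc, ∀ n, ‖(a n).1 θ - g.1 θ‖ ≤ ‖toLpTop (a n) - g‖ := by
    refine ae_all_iff.mpr fun n => ?_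
    filter_upwards [Lp.coeFn_sub (toLpTop (a n)) g,
      ae_le_eLpNormEssSup (f := (toLpTop (a n) - g : Lp ℂ ∞ arc)) (μ := arc)] with θ h1 h2
    rw [h1] at h2
    rw [Lp.norm_def, eLpNorm_exponent_top]
    have h3 := ENNReal.toReal_mono ?_ h2
    · rwa [toReal_enorm] at h3
    · rw [← eLpNorm_exponent_top]
      exact Lp.eLpNorm_ne_top _
  filter_upwards [h1, ae_all_iff.mpr ha] with θ h2 h3
  rw [Metric.tendsto_nhds]
  intro ε hε
  have h4 : ∀ᶠ n in atTop, ‖u n - T‖ < ε / 3 := by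
    simpa [dist_eq_norm] using Metric.tendsto_nhds.mp hlim (ε / 3) (by positivity)
  have h5 : ∀ᶠ n in atTop, ‖toLpTop (a n) - g‖ < ε / 3 := by
    simpa [dist_eq_norm] using Metric.tendsto_nhds.mp hg (ε / 3) (by positivity)
  obtain ⟨n, hn1, hn2⟩ := (h4.and h5).exists
  have h6 := Metric.tendsto_nhds.mp (h3 n) (ε / 3) (by positivity)
  filter_upwards [h6, eventually_norm_radial_lt_one θ] with r hr hr1
  rw [dist_zero_right] at hr ⊢
  have h7 := hV.norm_eq_one hr1
  set v := V (radial r θ)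
  have h8 : T v - g.1 θ • v =
      -((u n - T) v) + (u n v - (a n).1 θ • v) + ((a n).1 θ - g.1 θ) • v := by
    rw [_root_.sub_apply, sub_smul]
    abel
  have h9 : ‖(u n - T) v‖ < ε / 3 := by
    refine lt_of_le_of_lt ?_ hn1
    simpa [h7] using (u n - T).le_opNorm v
  have h10 : ‖((a n).1 θ - g.1 θ) • v‖ < ε / 3 := by
    rw [norm_smul, h7, mul_one]
    exact (h2 n).trans_lt hn2
  calc ‖T v - g.1 θ • v‖ ≤ ‖-((u n - T) v)‖ + ‖u n v - (a n).1 θ • v‖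
        + ‖((a n).1 θ - g.1 θ) • v‖ := by rw [h8]; exact norm_add₃_le
    _ < ε := by rw [norm_neg]; linarith

end LocallyMul

/-! ### Adjoints of generalized singular integral operators -/

lemma star_mulOp (f : Linf) : star (mulOp f) = mulOp (star f) := by
  rw [ContinuousLinearMap.star_eq_adjoint]
  refine ((ContinuousLinearMap.eq_adjoint_iff _ _).mpr fun x y => ?_).symm
  rw [L2.inner_def, L2.inner_def]
  refine integral_congr_ae ?_
  have h : (star f).1 =ᵐ[arc] star f.1 := AEEqFun.coeFn_star f.1
  filter_upwards [coeFn_mulOp f y, coeFn_mulOp (star f) x, h] with ω h1 h2 h3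
  rw [h1, h2, h3]
  simp [mul_assoc, mul_left_comm]

lemma star_Pplus : star Pplus = Pplus :=
  (isStarProjection_starProjection (U := H2)).isSelfAdjoint

lemma star_Pminus : star Pminus = Pminus := by
  rw [Pminus, star_sub, star_one, star_Pplus]

lemma star_gsio (H : Matrix (Fin 2) (Fin 2) Linf) : star (gsio H) = gsio Hᴴ := by
  simp only [gsio, star_add, star_mul, star_Pplus, star_Pminus, star_mulOp,
    Matrix.conjTranspose_apply, mul_assoc]
  abel

/-- The generators are closed under adjoints, so the plain algebra they generate is already a star
algebra. Induction over it needs no stability of `LocallyMul` under adjoints. -/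
lemma mem_gsioAlgebra_iff {T : L2 →L[ℂ] L2} :
    T ∈ gsioAlgebra ↔ T ∈ closure (Algebra.adjoin ℂ (Set.range gsio) : Set (L2 →L[ℂ] L2)) := by
  have h1 : star (Set.range gsio) = Set.range gsio := by
    refine (Set.Subset.antisymm ?_ ?_)
    · rintro S ⟨H, hH⟩
      exact ⟨Hᴴ, by rw [← star_gsio, hH, star_star]⟩
    · rintro _ ⟨H, rfl⟩
      exact ⟨Hᴴ, (star_gsio H).symm⟩
  have h2 := StarAlgebra.adjoin_toSubalgebra ℂ (Set.range gsio)
  rw [h1, Set.union_self] at h2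
  rw [gsioAlgebra, ← SetLike.mem_coe, StarSubalgebra.topologicalClosure_coe, ← h2]
  rfl

lemma gsio_mem_gsioAlgebra (H : Matrix (Fin 2) (Fin 2) Linf) : gsio H ∈ gsioAlgebra :=
  mem_gsioAlgebra_iff.mpr (subset_closure (Algebra.subset_adjoin ⟨H, rfl⟩))

lemma exists_locallyMul {V : ℂ → L2} {m : ℕ → ℤ} {w : ℂ → ℂ} (hV : IsKernelFamily V m w)
    (hg : ∀ H, ∃ a, LocallyMul V (gsio H) a) {T : L2 →L[ℂ] L2} (hT : T ∈ gsioAlgebra) :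
    ∃ a, LocallyMul V T a := by
  refine LocallyMul.exists_of_mem_closure hV (fun S hS => ?_) (mem_gsioAlgebra_iff.mp hT)
  induction hS using Algebra.adjoin_induction with
  | mem S hS =>
    obtain ⟨H, rfl⟩ := hS
    exact hg H
  | algebraMap c => exact ⟨_, LocallyMul.scalar c⟩
  | add S T _ _ hS hT =>
    obtain ⟨a, ha⟩ := hS
    obtain ⟨b, hb⟩ := hT
    exact ⟨_, ha.add hb⟩
  | mul S T _ _ hS hT =>
    obtain ⟨a, ha⟩ := hS
    obtain ⟨b, hb⟩ := hT
    exact ⟨_, ha.mul hb⟩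

/-! ### The symbol homomorphism -/

/-- `T` acts locally as multiplication on both families of kernels. -/
def HasLocalSymbol (T : L2 →L[ℂ] L2) (p : Linf × Linf) : Prop :=
  LocallyMul kernelPlus T p.1 ∧ LocallyMul kernelMinus T p.2

lemma HasLocalSymbol.hasSymbol {T : L2 →L[ℂ] L2} {p : Linf × Linf} (h : HasLocalSymbol T p) :
    HasSymbol T p :=
  ⟨h.1.tendsto_inner isKernelFamily_kernelPlus, h.2.tendsto_inner isKernelFamily_kernelMinus⟩

lemma symbolMap_eq {T : gsioAlgebra} {p : Linf × Linf} (h : HasSymbol T.1 p) :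
    symbolMap T = p := by
  have hex : ∃ p, HasSymbol T.1 p := ⟨p, h⟩
  rw [symbolMap, dif_pos hex]
  exact hex.choose_spec.unique h

lemma hasLocalSymbol_gsio (H : Matrix (Fin 2) (Fin 2) Linf) :
    HasLocalSymbol (gsio H) (H 0 0, H 1 1) :=
  ⟨locallyMul_kernelPlus_gsio H, locallyMul_kernelMinus_gsio H⟩

/-- The pair chosen through quadratic forms is the local symbol, by uniqueness of limits; all
algebraic identities for `symbolMap` rest on this. -/
lemma hasLocalSymbol_symbolMap (T : gsioAlgebra) : HasLocalSymbol T.1 (symbolMap T) := by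
  obtain ⟨a, ha⟩ := exists_locallyMul isKernelFamily_kernelPlus
    (fun H => ⟨_, locallyMul_kernelPlus_gsio H⟩) T.2
  obtain ⟨b, hb⟩ := exists_locallyMul isKernelFamily_kernelMinus
    (fun H => ⟨_, locallyMul_kernelMinus_gsio H⟩) T.2
  have h : HasLocalSymbol T.1 (a, b) := ⟨ha, hb⟩
  rwa [symbolMap_eq h.hasSymbol]

lemma tendsto_inner_star {S : ℝ → L2} {T : L2 →L[ℂ] L2} {c : ℂ}
    (h : Tendsto (fun r => ⟪S r, T (S r)⟫_ℂ) (𝓝[<] 1) (𝓝 c)) :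
    Tendsto (fun r => ⟪S r, (star T) (S r)⟫_ℂ) (𝓝[<] 1) (𝓝 (star c)) := by
  refine h.star.congr fun r => ?_
  rw [ContinuousLinearMap.star_eq_adjoint, ContinuousLinearMap.adjoint_inner_right]
  exact inner_conj_symm _ _

/-- Quadratic forms are simply conjugated by the adjoint, so the weak form of the symbol is the
convenient one here. -/
lemma HasSymbol.star {T : L2 →L[ℂ] L2} {p : Linf × Linf} (h : HasSymbol T p) :
    HasSymbol (star T) (star p) := by
  have h1 : (Star.star p.1).1 =ᵐ[arc] Star.star p.1.1 := AEEqFun.coeFn_star p.1.1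
  have h2 : (Star.star p.2).1 =ᵐ[arc] Star.star p.2.1 := AEEqFun.coeFn_star p.2.1
  constructor
  · filter_upwards [h.1, h1] with θ h3 h4
    rw [Prod.fst_star, h4]
    exact tendsto_inner_star h3
  · filter_upwards [h.2, h2] with θ h3 h4
    rw [Prod.snd_star, h4]
    exact tendsto_inner_star h3

/-- The symbol map as a unital *-homomorphism. -/
def symbolHom : gsioAlgebra →⋆ₐ[ℂ] (Linf × Linf) where
  toFun := symbolMap
  map_one' := symbolMap_eq (HasLocalSymbol.hasSymbol
    ⟨by simpa using LocallyMul.scalar (V := kernelPlus) 1,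
      by simpa using LocallyMul.scalar (V := kernelMinus) 1⟩)
  map_zero' := symbolMap_eq (HasLocalSymbol.hasSymbol
    ⟨by simpa using LocallyMul.scalar (V := kernelPlus) 0,
      by simpa using LocallyMul.scalar (V := kernelMinus) 0⟩)
  map_mul' S T := symbolMap_eq (HasLocalSymbol.hasSymbol
    ⟨(hasLocalSymbol_symbolMap S).1.mul (hasLocalSymbol_symbolMap T).1,
      (hasLocalSymbol_symbolMap S).2.mul (hasLocalSymbol_symbolMap T).2⟩)
  map_add' S T := symbolMap_eq (HasLocalSymbol.hasSymbol
    ⟨(hasLocalSymbol_symbolMap S).1.add (hasLocalSymbol_symbolMap T).1,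
      (hasLocalSymbol_symbolMap S).2.add (hasLocalSymbol_symbolMap T).2⟩)
  commutes' c := symbolMap_eq (HasLocalSymbol.hasSymbol
    ⟨LocallyMul.scalar c, LocallyMul.scalar c⟩)
  map_star' T := symbolMap_eq (hasLocalSymbol_symbolMap T).hasSymbol.star

/-! ### Compact operators -/

open InnerProductSpace in
/-- A closed space of operators that contains the operators of rank one contains the compact
operators. -/
lemma mem_of_isCompactOperator {W : Submodule ℂ (L2 →L[ℂ] L2)}
    (hW : IsClosed (W : Set (L2 →L[ℂ] L2))) (h1 : ∀ x y, rankOne ℂ x y ∈ W) {K : L2 →L[ℂ] L2}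
    (hK : IsCompactOperator K) : K ∈ W := by
  refine hW.closure_subset_iff.mpr subset_rfl (Metric.mem_closure_iff.mpr fun ε hε => ?_)
  have htb : TotallyBounded (K '' Metric.closedBall 0 1) :=
    (IsCompactOperator.isCompact_closure_image_closedBall
      (f := (K : L2 →ₗ[ℂ] L2)) hK 1).totallyBounded.subset subset_closure
  obtain ⟨t, htf, hcov⟩ := Metric.totallyBounded_iff.mp htb (ε / 2) (by positivity)
  -- Projecting onto the span of a finite ε/2-net of the image of the unit ball moves `K` by at most
  -- ε/2.
  set U := Submodule.span ℂ t
  have : FiniteDimensional ℂ U := FiniteDimensional.span_of_finite ℂ htf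
  refine ⟨U.starProjection ∘L K, ?_, ?_⟩
  · rw [(stdOrthonormalBasis ℂ U).starProjection_eq_sum_rankOne, ContinuousLinearMap.finsetSum_comp]
    refine W.sum_mem fun i _ => ?_
    rw [rankOne_comp]
    exact h1 _ _
  · rw [dist_eq_norm]
    refine lt_of_le_of_lt (ContinuousLinearMap.opNorm_le_of_unit_norm (by positivity)
      fun x hx => ?_) (half_lt_self hε)
    obtain ⟨y, hy, hxy⟩ := Set.mem_iUnion₂.mp (hcov ⟨x, by simp [hx], rfl⟩)
    rw [Metric.mem_ball, dist_eq_norm] at hxy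
    have h2 : ‖K x - U.starProjection (K x)‖ ≤ ‖K x - y‖ := by
      rw [U.starProjection_minimal (K x)]
      exact ciInf_le ⟨0, by rintro _ ⟨u, rfl⟩; exact norm_nonneg _⟩
        (⟨y, Submodule.subset_span hy⟩ : U)
    exact h2.trans hxy.le

lemma isCompactOperator_of_hasFiniteRange {F : L2 →L[ℂ] L2}
    (hF : (F : L2 →ₗ[ℂ] L2).HasFiniteRange) : IsCompactOperator F := by
  have : FiniteDimensional ℂ (F : L2 →ₗ[ℂ] L2).range := Module.Finite.of_fg hF
  have h1 : IsCompactOperator (Submodule.subtypeL (F : L2 →ₗ[ℂ] L2).range) :=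
    isCompactOperator_of_locallyCompactSpace_rng _
  exact h1.comp_clm (F.codRestrict (F : L2 →ₗ[ℂ] L2).range fun x => ⟨x, rfl⟩)

lemma eq_top_of_expVec_mem {W : Submodule ℂ L2} (hW : IsClosed (W : Set L2))
    (h : ∀ i, expVec i ∈ W) : W = ⊤ := by
  have h1 := Submodule.topologicalClosure_minimal (Submodule.span ℂ (Set.range expVec))
    (Submodule.span_le.mpr (by rintro _ ⟨i, rfl⟩; exact h i)) hW
  rw [span_fourierLp_closure_eq_top (p := 2) ENNReal.ofNat_ne_top] at h1
  exact top_le_iff.mp h1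

lemma ext_expVec {S T : L2 →L[ℂ] L2} (h : ∀ i, S (expVec i) = T (expVec i)) : S = T := by
  have h1 := eq_top_of_expVec_mem (W := (S.eqLocus T)) (ContinuousLinearMap.isClosed_eqLocus S T) h
  ext1 x
  have : x ∈ S.eqLocus T := h1 ▸ Submodule.mem_top
  exact this

namespace IsKernelFamily

variable {V : ℂ → L2} {m : ℕ → ℤ} {w : ℂ → ℂ}

/-- Weak convergence to 0: since the kernels have norm one, the good x form a closed subspace, and
it contains every exponential. -/
lemma tendsto_inner (h : IsKernelFamily V m w) (x : L2) (θ : Torus) :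
    Tendsto (fun r : ℝ => ⟪x, V (radial r θ)⟫_ℂ) (𝓝[<] 1) (𝓝 0) := by
  let W : Submodule ℂ L2 :=
    { carrier := {x | Tendsto (fun r : ℝ => ⟪x, V (radial r θ)⟫_ℂ) (𝓝[<] 1) (𝓝 0)}
      add_mem' := fun {x y} hx hy => by
        simpa [inner_add_left] using Tendsto.add hx hy
      zero_mem' := by simp
      smul_mem' := fun c x hx => by
        simpa [inner_smul_left] using Tendsto.const_mul ((starRingEnd ℂ) c) hx }
  suffices hW : IsClosed (W : Set L2) by
    have : x ∈ W := eq_top_of_expVec_mem hW (fun i => h.tendsto_inner_expVec i θ) ▸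
      Submodule.mem_top
    exact this
  refine isClosed_of_closure_subset fun y hy => ?_
  change Tendsto _ _ _
  rw [Metric.tendsto_nhds]
  intro ε hε
  obtain ⟨z, hz, hyz⟩ := Metric.mem_closure_iff.mp hy (ε / 2) (by positivity)
  filter_upwards [Metric.tendsto_nhds.mp hz (ε / 2) (by positivity),
    eventually_norm_radial_lt_one θ] with r h1 h2
  rw [dist_zero_right] at h1 ⊢
  rw [dist_eq_norm] at hyz
  have h3 := norm_inner_le_norm (𝕜 := ℂ) (y - z) (V (radial r θ))
  rw [h.norm_eq_one h2, mul_one] at h3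
  have h4 : ⟪y, V (radial r θ)⟫_ℂ = ⟪y - z, V (radial r θ)⟫_ℂ + ⟪z, V (radial r θ)⟫_ℂ := by
    rw [← inner_add_left, sub_add_cancel]
  rw [h4]
  linarith [norm_add_le ⟪y - z, V (radial r θ)⟫_ℂ ⟪z, V (radial r θ)⟫_ℂ]

/-- For rank one operators this is weak convergence of the kernels; the operators with this property
form a closed subspace. -/
lemma tendsto_of_isCompactOperator (h : IsKernelFamily V m w) {K : L2 →L[ℂ] L2}
    (hK : IsCompactOperator K) (θ : Torus) :
    Tendsto (fun r : ℝ => K (V (radial r θ))) (𝓝[<] 1) (𝓝 0) := by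
  let W : Submodule ℂ (L2 →L[ℂ] L2) :=
    { carrier := {K | Tendsto (fun r : ℝ => K (V (radial r θ))) (𝓝[<] 1) (𝓝 0)}
      add_mem' := fun {x y} hx hy => by simpa using Tendsto.add hx hy
      zero_mem' := by simp
      smul_mem' := fun c x hx => by simpa using Tendsto.const_smul hx c }
  suffices hW : IsClosed (W : Set (L2 →L[ℂ] L2)) by
    refine mem_of_isCompactOperator hW (fun x y => ?_) hK
    change Tendsto _ _ _
    simpa using (h.tendsto_inner y θ).smul_const x
  refine isClosed_of_closure_subset fun S hS => ?_
  change Tendsto _ _ _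
  rw [Metric.tendsto_nhds]
  intro ε hε
  obtain ⟨T, hT, hST⟩ := Metric.mem_closure_iff.mp hS (ε / 2) (by positivity)
  filter_upwards [Metric.tendsto_nhds.mp hT (ε / 2) (by positivity),
    eventually_norm_radial_lt_one θ] with r h1 h2
  rw [dist_zero_right] at h1 ⊢
  rw [dist_eq_norm] at hST
  have h3 := (S - T).le_opNorm (V (radial r θ))
  rw [h.norm_eq_one h2, mul_one] at h3
  have h4 : S (V (radial r θ)) = (S - T) (V (radial r θ)) + T (V (radial r θ)) := by simp
  rw [h4]
  linarith [norm_add_le ((S - T) (V (radial r θ))) (T (V (radial r θ)))]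

end IsKernelFamily

lemma locallyMul_zero_of_isCompactOperator {V : ℂ → L2} {m : ℕ → ℤ} {w : ℂ → ℂ}
    (hV : IsKernelFamily V m w) {K : L2 →L[ℂ] L2} (hK : IsCompactOperator K) :
    LocallyMul V K 0 := by
  filter_upwards [AEEqFun.coeFn_zero (α := Torus) (β := ℂ) (μ := arc)] with θ hθ
  have h : (0 : Linf).1 θ = 0 := hθ
  simpa [h] using hV.tendsto_of_isCompactOperator hK θ

lemma symbolMap_eq_zero {T : gsioAlgebra} (hT : T ∈ compactIdeal) : symbolMap T = 0 :=
  symbolMap_eq (HasLocalSymbol.hasSymbol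
    ⟨locallyMul_zero_of_isCompactOperator isKernelFamily_kernelPlus hT,
      locallyMul_zero_of_isCompactOperator isKernelFamily_kernelMinus hT⟩)

/-! ### The algebra contains the compact operators -/

/-- The function `z ^ n` as an element of `L^∞`. -/
def expLinf (n : ℤ) : Linf := ⟨(fourierLp ∞ n).1, (fourierLp ∞ n).2⟩

lemma mulOp_expLinf (n k : ℤ) : mulOp (expLinf n) (expVec k) = expVec (n + k) := by
  refine Lp.ext ?_
  filter_upwards [coeFn_mulOp (expLinf n) (expVec k), coeFn_fourierLp (T := 2 * Real.pi) ∞ n,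
    coeFn_fourierLp (T := 2 * Real.pi) 2 k, coeFn_fourierLp (T := 2 * Real.pi) 2 (n + k)]
    with ω h1 h2 h3 h4
  rw [h1, h3, h4, fourier_add, ← h2]
  rfl

lemma Pplus_expVec (k : ℤ) : Pplus (expVec k) = if 0 ≤ k then expVec k else 0 := by
  split_ifs with h
  · lift k to ℕ using h
    exact Pplus_apply_of_mem (expVec_natCast_mem_H2 k)
  · exact Pplus_apply_of_mem_orthogonal (expVec_mem_H2_orthogonal (not_le.mp h))

lemma mulOp_one : mulOp 1 = 1 := by
  ext1 v
  refine Lp.ext ?_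
  filter_upwards [coeFn_mulOp 1 v, AEEqFun.coeFn_one (α := Torus) (β := ℂ) (μ := arc)] with ω h1 h2
  have h : (1 : Linf).1 ω = 1 := h2
  rw [h1, h, one_mul]
  rfl

lemma mulOp_zero : mulOp 0 = 0 := by
  have h : toLpTop 0 = 0 := rfl
  rw [mulOp, h, map_zero]

lemma Pplus_mem_gsioAlgebra : Pplus ∈ gsioAlgebra := by
  have h : gsio !![1, 0; 0, 0] = Pplus := by
    have : Pplus * Pplus = Pplus :=
      (isStarProjection_starProjection (U := H2)).isIdempotentElem.eq
    simpa [gsio, mulOp_one, mulOp_zero] using this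
  exact h ▸ gsio_mem_gsioAlgebra _

lemma mulOp_mem_gsioAlgebra (f : Linf) : mulOp f ∈ gsioAlgebra := by
  have h : gsio !![f, f; f, f] = mulOp f := by
    simp only [gsio, Matrix.of_apply, Matrix.cons_val', Matrix.cons_val_zero, Matrix.cons_val_one,
      Matrix.cons_val_fin_one, Pminus]
    noncomm_ring
  exact h ▸ gsio_mem_gsioAlgebra _

open InnerProductSpace in
-- P₊ - z P₊ z̄ projects onto the constants; multiplication by z⁻ʲ beforehand and by zⁱ afterwards
-- turns it into the matrix unit sending zʲ to zⁱ.
lemma rankOne_expVec_mem_gsioAlgebra (i j : ℤ) :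
    rankOne ℂ (expVec i) (expVec j) ∈ gsioAlgebra := by
  have h : rankOne ℂ (expVec i) (expVec j) = mulOp (expLinf i) *
      (Pplus - mulOp (expLinf 1) * Pplus * mulOp (expLinf (-1))) * mulOp (expLinf (-j)) := by
    refine ext_expVec fun k => ?_
    simp only [rankOne_apply, mul_apply_eq_comp, _root_.sub_apply, mulOp_expLinf, Pplus_expVec,
      inner_expVec, map_sub, apply_ite (mulOp _), map_zero]
    rcases lt_trichotomy k j with h | h | h
    · rw [if_neg (by omega), if_neg (by omega), if_neg (by omega)]
      simp
    · subst h
      simp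
    · rw [if_neg (by omega), if_pos (by omega), if_pos (by omega)]
      rw [zero_smul]
      refine (sub_eq_zero.mpr ?_).symm
      congr 1
      ring
  rw [h]
  have hm := mulOp_mem_gsioAlgebra
  have hP := Pplus_mem_gsioAlgebra
  exact mul_mem (mul_mem (hm _) (sub_mem hP (mul_mem (mul_mem (hm _) hP) (hm _)))) (hm _)

lemma isClosed_gsioAlgebra : IsClosed (gsioAlgebra : Set (L2 →L[ℂ] L2)) :=
  StarSubalgebra.isClosed_topologicalClosure _

open InnerProductSpace in
lemma rankOne_mem_gsioAlgebra (x y : L2) : rankOne ℂ x y ∈ gsioAlgebra := by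
  let W1 (j : ℤ) : Submodule ℂ L2 :=
    { carrier := {x | rankOne ℂ x (expVec j) ∈ gsioAlgebra}
      add_mem' := fun {a b} ha hb => by simpa using add_mem ha hb
      zero_mem' := by simp
      smul_mem' := fun c a ha => by simpa using SMulMemClass.smul_mem c ha }
  have h1 : ∀ j, rankOne ℂ x (expVec j) ∈ gsioAlgebra := fun j => by
    have hc : IsClosed (W1 j : Set L2) := isClosed_gsioAlgebra.preimage (by fun_prop)
    have : x ∈ W1 j := eq_top_of_expVec_mem hc (fun i => rankOne_expVec_mem_gsioAlgebra i j) ▸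
      Submodule.mem_top
    exact this
  let W2 : Submodule ℂ L2 :=
    { carrier := {y | rankOne ℂ x y ∈ gsioAlgebra}
      add_mem' := fun {a b} ha hb => by simpa using add_mem ha hb
      zero_mem' := by simp
      -- `rankOne` is conjugate linear in its second argument.
      smul_mem' := fun c a ha => by simpa using SMulMemClass.smul_mem (star c) ha }
  have hc : IsClosed (W2 : Set L2) := isClosed_gsioAlgebra.preimage (by fun_prop)
  have : y ∈ W2 := eq_top_of_expVec_mem hc h1 ▸ Submodule.mem_top
  exact this

lemma mem_gsioAlgebra_of_isCompactOperator {K : L2 →L[ℂ] L2} (hK : IsCompactOperator K) :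
    K ∈ gsioAlgebra :=
  mem_of_isCompactOperator (W := gsioAlgebra.toSubalgebra.toSubmodule) isClosed_gsioAlgebra
    rankOne_mem_gsioAlgebra hK

/-! ### Fredholm operators -/

/-- If ST - 1 has finite rank, then 1 = ‖V‖ ≤ ‖S‖ ‖TV‖ + ‖(ST - 1)V‖. The last term vanishes in the
limit and ‖TV‖ → |a(θ)|, so C = ‖S‖ works. -/
lemma LocallyMul.exists_ae_one_le_of_isFredholm {V : ℂ → L2} {m : ℕ → ℤ} {w : ℂ → ℂ}
    {T : L2 →L[ℂ] L2} {a : Linf} (hT : LocallyMul V T a) (hV : IsKernelFamily V m w)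
    (hF : T.IsFredholm) : ∃ C : ℝ, 0 ≤ C ∧ ∀ᵐ θ ∂arc, 1 ≤ C * ‖a.1 θ‖ := by
  obtain ⟨S, hS, -⟩ := hF.exists_isQuasiInverse
  have hK : IsCompactOperator (S * T - 1 : L2 →L[ℂ] L2) := by
    refine isCompactOperator_of_hasFiniteRange ?_
    exact LinearMap.FiniteRangeSetoid.equiv_iff_hasFiniteRange.mp hS
  refine ⟨‖S‖, norm_nonneg _, ?_⟩
  filter_upwards [hT.tendsto_norm hV] with θ hθ
  have h1 := (hθ.const_mul ‖S‖).add (hV.tendsto_of_isCompactOperator hK θ).norm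
  rw [norm_zero, add_zero] at h1
  refine ge_of_tendsto h1 ?_
  filter_upwards [eventually_norm_radial_lt_one θ] with r hr
  have h2 : V (radial r θ) = S (T (V (radial r θ))) - (S * T - 1) (V (radial r θ)) := by
    simp
  calc 1 = ‖V (radial r θ)‖ := (hV.norm_eq_one hr).symm
    _ ≤ ‖S (T (V (radial r θ)))‖ + ‖(S * T - 1) (V (radial r θ))‖ := by
        conv_lhs => rw [h2]
        exact norm_sub_le _ _
    _ ≤ _ := by
        gcongr
        exact S.le_opNorm _

lemma isUnit_of_ae_one_le {a : Linf} {C : ℝ} (h : ∀ᵐ θ ∂arc, 1 ≤ C * ‖a.1 θ‖) :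
    IsUnit a := by
  have hm : AEStronglyMeasurable (fun θ => (a.1 θ)⁻¹) arc :=
    a.1.aestronglyMeasurable.aemeasurable.inv.aestronglyMeasurable
  have hpos : ∀ᵐ θ ∂arc, a.1 θ ≠ 0 := by
    filter_upwards [h] with θ h h0
    rw [h0, norm_zero, mul_zero] at h
    linarith
  have hb : AEEqFun.mk _ hm ∈ Linf := by
    change AEEqFun.mk _ hm ∈ Lp ℂ ∞ arc
    rw [Lp.mem_Lp_iff_memLp, memLp_congr_ae (AEEqFun.coeFn_mk _ hm)]
    refine memLp_top_of_bound hm C ?_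
    filter_upwards [h, hpos] with θ h1 h2
    rw [norm_inv]
    rwa [inv_le_iff_one_le_mul₀ (norm_pos_iff.mpr h2)]
  refine IsUnit.of_mul_eq_one ⟨_, hb⟩ (Subtype.ext (AEEqFun.ext ?_))
  filter_upwards [AEEqFun.coeFn_mul a.1 (AEEqFun.mk _ hm), AEEqFun.coeFn_mk _ hm, hpos,
    AEEqFun.coeFn_one (α := Torus) (β := ℂ) (μ := arc)] with θ h1 h2 h3 h4
  refine h1.trans (Eq.trans ?_ h4.symm)
  rw [Pi.mul_apply, h2, mul_inv_cancel₀ h3, Pi.one_apply]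

lemma essRange_subset_essSpectrum {V : ℂ → L2} {m : ℕ → ℤ} {w : ℂ → ℂ}
    (hV : IsKernelFamily V m w) {T : L2 →L[ℂ] L2} {a : Linf} (hT : LocallyMul V T a) :
    essRange a ⊆ essSpectrum T := by
  intro c hc hF
  have h1 : LocallyMul V (T - c • (1 : L2 →L[ℂ] L2)) (a - algebraMap ℂ Linf c) := by
    rw [← Algebra.algebraMap_eq_smul_one]
    exact hT.sub (LocallyMul.scalar c)
  obtain ⟨C, hC, h⟩ := h1.exists_ae_one_le_of_isFredholm hV hF
  -- The radius is chosen so that C(C + 1)⁻¹ < 1, including the case C = 0.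
  refine (hc (C + 1)⁻¹ (by positivity)).ne' (measure_eq_zero_iff_ae_notMem.mpr ?_)
  filter_upwards [h, AEEqFun.coeFn_sub a.1 (algebraMap ℂ Linf c).1,
    LocallyMul.coeFn_algebraMap c] with θ h1 h2 h3 (h4 : ‖a.1 θ - c‖ < (C + 1)⁻¹)
  have h5 : (a - algebraMap ℂ Linf c).1 θ = a.1 θ - c := by
    refine h2.trans ?_
    rw [Pi.sub_apply, h3]
  rw [h5] at h1
  have h6 : C * ‖a.1 θ - c‖ ≤ C * (C + 1)⁻¹ := by gcongr
  have h7 : C * (C + 1)⁻¹ < 1 := by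
    rw [← div_eq_mul_inv, div_lt_one (by positivity)]
    linarith
  linarith

end GSIO

end

open GSIO

theorem mainTheorem5 :
    (∀ K : L2 →L[ℂ] L2, IsCompactOperator K → K ∈ gsioAlgebra) ∧
    (∀ T : gsioAlgebra, HasSymbol (T : L2 →L[ℂ] L2) (symbolMap T)) ∧
    (∃ ζ : (gsioAlgebra ⧸ compactIdeal) →⋆ₐ[ℂ] (Linf × Linf),
      Function.Surjective ζ ∧
      ∀ T : gsioAlgebra, ζ (Ideal.Quotient.mk compactIdeal T) = symbolMap T) ∧
    (∀ T : gsioAlgebra, (T : L2 →L[ℂ] L2).IsFredholm → IsUnit (symbolMap T)) ∧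
    (∀ f g φ ψ : Linf,
      essRange f ∪ essRange ψ ⊆ essSpectrum (gsio !![f, φ; g, ψ])) := by
  refine ⟨fun K hK => mem_gsioAlgebra_of_isCompactOperator hK,
    fun T => (hasLocalSymbol_symbolMap T).hasSymbol, ?_, fun T hT => ?_, fun f g φ ψ => ?_⟩
  · refine ⟨{ Ideal.Quotient.liftₐ compactIdeal symbolHom.toAlgHom
        (fun _ hT => symbolMap_eq_zero hT) with
      map_star' := ?_ }, fun p => ?_, fun T => rfl⟩
    · rintro ⟨T⟩
      exact map_star symbolHom T
    -- The off-diagonal entries do not affect the symbol, so a diagonal matrix realises any pair.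
    · refine ⟨Ideal.Quotient.mk compactIdeal ⟨gsio !![p.1, 0; 0, p.2], gsio_mem_gsioAlgebra _⟩, ?_⟩
      exact symbolMap_eq (hasLocalSymbol_gsio _).hasSymbol
  · obtain ⟨h1, h2⟩ := hasLocalSymbol_symbolMap T
    obtain ⟨C, -, hC⟩ := h1.exists_ae_one_le_of_isFredholm isKernelFamily_kernelPlus hT
    obtain ⟨D, -, hD⟩ := h2.exists_ae_one_le_of_isFredholm isKernelFamily_kernelMinus hT
    exact Prod.isUnit_iff.mpr ⟨isUnit_of_ae_one_le hC, isUnit_of_ae_one_le hD⟩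
  · obtain ⟨h1, h2⟩ := hasLocalSymbol_gsio !![f, φ; g, ψ]
    exact Set.union_subset (essRange_subset_essSpectrum isKernelFamily_kernelPlus h1)
      (essRange_subset_essSpectrum isKernelFamily_kernelMinus h2)
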